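/- Let $d,p\ge 1$, $N\ge 0$ be integers, let $L,\beta>0$, $\Lambda_L=[-L/2,L/2]^d$, $\mathcal H_L=L^2(\Lambda_L)$ (complex, Lebesgue measure), and identify the Hilbert space tensor power $\otimes^N\mathcal H_L$ with $L^2(\Lambda_L^N)$. For $\sigma\in\mathcal S_N$ let $(U(\sigma)F)(x_1,\dots,x_N)=F(x_{\sigma(1)},\dots,x_{\sigma(N)})$, and extend $U$ linearly to $\mathbb C[\mathcal S_N]$. Let $G_L=e^{\beta\triangle_L}$, where $\triangle_L$ is the Laplacian on $\Lambda_L$ with periodic boundary conditions; that is, $G_L=\sum_{k\in\mathbb Z^d}e^{-\beta|2\pi k/L|^2}\langle e_k,\cdot\rangle e_k$ with $e_k(x)=L^{-d/2}e^{2\pi i k\cdot x/L}$. Let $f\ge 0$ be a continuous function on $\Lambda_L$ and let $\tilde G_L=G_L^{1/2}e^{-f}G_L^{1/2}$. Write $G_L(x,y)$, $\tilde G_L(x,y)$ for the continuous integral kernels of these operators. For a Young tableau $T$ with $N$ boxes (a bijection from $\{1,\dots,N\}$ to the boxes of a Young frame) let $\mathcal R(T)$, $\mathcal C(T)$ be its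 row and column stabilizers in $\mathcal S_N$, $T'$ the transposed tableau, $\chi_T$ and $d_T$ the character and the dimension of the irreducible representation of $\mathcal S_N$ corresponding to $T$ (the left ideal of $\mathbb C[\mathcal S_N]$ generated by $\sum_{\sigma\in\mathcal R(T)}\sum_{\tau\in\mathcal C(T)}\mathrm{sgn}(\tau)\,\sigma\tau$), and $$a(T)=\frac1{\#\mathcal R(T)}\sum_{\sigma\in\mathcal R(T)}\sigma,\qquad e(T)=\frac{d_T}{N!}\sum_{\sigma\in\mathcal R(T)}\sum_{\tau\in\mathcal C(T)}\mathrm{sgn}(\tau)\,\sigma\tau,\qquad d(T)=e(T)a(T).$$ For an $N\times N$ matrix $A$ let $\det_T A=\sum_{\sigma\in\mathcal S_N}\chi_T(\sigma)\prod_{i=1}^N A_{i\sigma(i)}$ (immanant). Fix a set $\mathcal T_p^N$ that contains exactly one tableau on each Young frame with $N$ boxes and at most $p$ rows. The generating functionals of $N$ free para-fermions, resp. para-bosons, of order $p$ in $\Lambda_L$ are $$E^{pF}_{L,N}\big[e^{-\langle f,\xi\rangle}\big]=\frac{\sum_{T\in\mathcal T_p^N}\mathrm{Tr}\big[(\otimes^N\tilde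 G_L)U(d(T'))\big]}{\sum_{T\in\mathcal T_p^N}\mathrm{Tr}\big[(\otimes^N G_L)U(d(T'))\big]},\qquad E^{pB}_{L,N}\big[e^{-\langle f,\xi\rangle}\big]=\frac{\mathrm{Tr}\big[(\otimes^N\tilde G_L)P_{pB}\big]}{\mathrm{Tr}\big[(\otimes^N G_L)P_{pB}\big]},\qquad P_{pB}=\sum_{T\in\mathcal T_p^N}U(d(T)).$$ Then all these objects are well defined: the operators $\otimes^N G_L$, $\otimes^N\tilde G_L$ and the continuous kernels $G_L(x,y)$, $\tilde G_L(x,y)$ exist and are unique, the operators $(\otimes^N G_L)U(\sigma)$ and $(\otimes^N\tilde G_L)U(\sigma)$ are of trace class, and no denominator above or below vanishes. Moreover $$E^{pF}_{L,N}\big[e^{-\langle f,\xi\rangle}\big] =\frac{\sum_{T\in\mathcal T_p^N}\sum_{\sigma\in\mathcal S_N}\chi_{T'}(\sigma)\,\mathrm{Tr}\big[(\otimes^N\tilde G_L)U(\sigma)\big]}{\sum_{T\in\mathcal T_p^N}\sum_{\sigma\in\mathcal S_N}\chi_{T'}(\sigma)\,\mathrm{Tr}\big[(\otimes^N G_L)U(\sigma)\big]}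 =\frac{\sum_{T\in\mathcal T_p^N}\int_{\Lambda_L^N}\det_{T'}\{\tilde G_L(x_i,x_j)\}_{1\le i,j\le N}\,dx_1\cdots dx_N}{\sum_{T\in\mathcal T_p^N}\int_{\Lambda_L^N}\det_{T'}\{G_L(x_i,x_j)\}_{1\le i,j\le N}\,dx_1\cdots dx_N}$$ and $$E^{pB}_{L,N}\big[e^{-\langle f,\xi\rangle}\big] =\frac{\sum_{T\in\mathcal T_p^N}\sum_{\sigma\in\mathcal S_N}\chi_{T}(\sigma)\,\mathrm{Tr}\big[(\otimes^N\tilde G_L)U(\sigma)\big]}{\sum_{T\in\mathcal T_p^N}\sum_{\sigma\in\mathcal S_N}\chi_{T}(\sigma)\,\mathrm{Tr}\big[(\otimes^N G_L)U(\sigma)\big]} =\frac{\sum_{T\in\mathcal T_p^N}\int_{\Lambda_L^N}\det_{T}\{\tilde G_L(x_i,x_j)\}_{1\le i,j\le N}\,dx_1\cdots dx_N}{\sum_{T\in\mathcal T_p^N}\int_{\Lambda_L^N}\det_{T}\{G_L(x_i,x_j)\}_{1\le i,j\le N}\,dx_1\cdots dx_N}.$$ -/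

import Mathlib

noncomputable section

namespace ParaStat

open MeasureTheory
open scoped ENNReal BigOperators

/-! ### Young frames, tableaux and the group algebra of the symmetric group -/

/-- The symmetric group on `N` letters. -/
abbrev Sym (N : ℕ) : Type := Equiv.Perm (Fin N)

/-- The complex group algebra of the symmetric group. -/
abbrev GrpAlg (N : ℕ) : Type := MonoidAlgebra ℂ (Sym N)

/-- Young frames with `N` boxes and length (number of rows) at most `p`. -/
abbrev Frame (p N : ℕ) : Type := {μ : YoungDiagram // μ.card = N ∧ μ.colLen 0 ≤ p}

theorem mem_range_of_mem_cells (μ : YoungDiagram) {c : ℕ × ℕ} (hc : c ∈ μ.cells) :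
    c ∈ Finset.range μ.card ×ˢ Finset.range μ.card := by
  obtain ⟨i, j⟩ := c
  have hrow : (Finset.range (j + 1)).image (fun k => (i, k)) ⊆ μ.cells := by
    intro x hx
    obtain ⟨k, hk, rfl⟩ := Finset.mem_image.1 hx
    exact μ.up_left_mem le_rfl (Nat.lt_succ_iff.1 (Finset.mem_range.1 hk)) hc
  have hcol : (Finset.range (i + 1)).image (fun k => (k, j)) ⊆ μ.cells := by
    intro x hx
    obtain ⟨k, hk, rfl⟩ := Finset.mem_image.1 hx
    exact μ.up_left_mem (Nat.lt_succ_iff.1 (Finset.mem_range.1 hk)) le_rfl hc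
  have h1 := Finset.card_le_card hrow
  have h2 := Finset.card_le_card hcol
  rw [Finset.card_image_of_injective _ (fun a b h => by simpa using h),
    Finset.card_range] at h1 h2
  exact Finset.mem_product.2 ⟨Finset.mem_range.2 h2, Finset.mem_range.2 h1⟩

instance finite_frame (p N : ℕ) : Finite (Frame p N) := by
  let g : Frame p N → {s : Finset (ℕ × ℕ) // s ∈ (Finset.range N ×ˢ Finset.range N).powerset} :=
    fun μ => ⟨μ.1.cells, Finset.mem_powerset.2 fun c hc => by
      have h := mem_range_of_mem_cells μ.1 hc
      rwa [μ.2.1] at h⟩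
  refine Finite.of_injective g fun μ ν h => ?_
  exact Subtype.ext (YoungDiagram.ext (congrArg Subtype.val h))

instance fintype_frame (p N : ℕ) : Fintype (Frame p N) := Fintype.ofFinite _

/-- A Young tableau on a frame: a bijection from the `N` numbers to the boxes. -/
abbrev Tableau (N : ℕ) (μ : YoungDiagram) : Type := Fin N ≃ μ.cells

/-- The transposed tableau, on the transposed frame. -/
def Tableau.transpose {N : ℕ} {μ : YoungDiagram} (T : Tableau N μ) : Tableau N μ.transpose :=
  T.trans ((Equiv.prodComm ℕ ℕ).subtypeEquiv fun c => by
    simp [YoungDiagram.mem_cells, YoungDiagram.mem_transpose])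

/-- The row stabilizer `R(T)`. -/
def rowStab {N : ℕ} {μ : YoungDiagram} (T : Tableau N μ) : Subgroup (Sym N) where
  carrier := {σ | ∀ i, (T (σ i)).1.1 = (T i).1.1}
  one_mem' := fun _ => rfl
  mul_mem' := fun {σ τ} hσ hτ i => by
    rw [Equiv.Perm.mul_apply]; exact (hσ (τ i)).trans (hτ i)
  inv_mem' := fun {σ} hσ i => by
    have h := hσ (σ⁻¹ i)
    rw [show σ (σ⁻¹ i) = i from σ.apply_symm_apply i] at h
    exact h.symm

/-- The column stabilizer `C(T)`. -/
def colStab {N : ℕ} {μ : YoungDiagram} (T : Tableau N μ) : Subgroup (Sym N) where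
  carrier := {σ | ∀ i, (T (σ i)).1.2 = (T i).1.2}
  one_mem' := fun _ => rfl
  mul_mem' := fun {σ τ} hσ hτ i => by
    rw [Equiv.Perm.mul_apply]; exact (hσ (τ i)).trans (hτ i)
  inv_mem' := fun {σ} hσ i => by
    have h := hσ (σ⁻¹ i)
    rw [show σ (σ⁻¹ i) = i from σ.apply_symm_apply i] at h
    exact h.symm

/-- The sign of a permutation as a complex number. -/
def sgn {N : ℕ} (σ : Sym N) : ℂ := ((Equiv.Perm.sign σ : ℤ) : ℂ)

open Classical in
/-- `a(T)`, the normalized row symmetrizer. -/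
def rowSym {N : ℕ} {μ : YoungDiagram} (T : Tableau N μ) : GrpAlg N :=
  (Nat.card (rowStab T) : ℂ)⁻¹ • ∑ σ : rowStab T, MonoidAlgebra.of ℂ (Sym N) σ

open Classical in
/-- The (unnormalized) Young symmetrizer `∑_{σ ∈ R(T)} ∑_{τ ∈ C(T)} sgn(τ) σ τ`. -/
def youngSym {N : ℕ} {μ : YoungDiagram} (T : Tableau N μ) : GrpAlg N :=
  ∑ σ : rowStab T, ∑ τ : colStab T,
    sgn (τ : Sym N) • MonoidAlgebra.of ℂ (Sym N) ((σ : Sym N) * (τ : Sym N))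

/-- The space of the irreducible representation of the symmetric group that corresponds to `T`:
the left ideal of the group algebra generated by the Young symmetrizer. -/
abbrev irrep {N : ℕ} {μ : YoungDiagram} (T : Tableau N μ) : Submodule (GrpAlg N) (GrpAlg N) :=
  Submodule.span (GrpAlg N) {youngSym T}

/-- `χ_T`, the character of the irreducible representation corresponding to `T`. -/
def chi {N : ℕ} {μ : YoungDiagram} (T : Tableau N μ) : Sym N → ℂ :=
  (Representation.ofModule' (k := ℂ) (G := Sym N) (irrep T)).character

/-- `d_T`, the dimension of the irreducible representation corresponding to `T`. -/
def irrepDim {N : ℕ} {μ : YoungDiagram} (T : Tableau N μ) : ℕ := Module.finrank ℂ (irrep T)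

/-- `e(T)`, the normalized Young symmetrizer. -/
def eElt {N : ℕ} {μ : YoungDiagram} (T : Tableau N μ) : GrpAlg N :=
  ((irrepDim T : ℂ) / (N.factorial : ℂ)) • youngSym T

/-- `d(T) = e(T) a(T)`. -/
def dElt {N : ℕ} {μ : YoungDiagram} (T : Tableau N μ) : GrpAlg N := eElt T * rowSym T

/-- The immanant `det_T A = ∑_σ χ_T(σ) ∏_i A_{i σ(i)}`. -/
def immanant {N : ℕ} {μ : YoungDiagram} (T : Tableau N μ) (A : Matrix (Fin N) (Fin N) ℂ) : ℂ :=
  ∑ σ : Sym N, chi T σ * ∏ i, A i (σ i)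

/-! ### The trace of a bounded operator on a Hilbert space -/

/-- `A` has trace `t`: for every orthonormal basis `b` the series `∑ ⟨b i, A b i⟩` converges
unconditionally to `t`. -/
def HasOpTrace {H : Type} [NormedAddCommGroup H] [InnerProductSpace ℂ H]
    (A : H →L[ℂ] H) (t : ℂ) : Prop :=
  ∀ (ι : Type) (b : HilbertBasis ι ℂ H), HasSum (fun i => inner ℂ (b i) (A (b i))) t

/-- Trace class operators: those with summable diagonal in every orthonormal basis, with a sum
that does not depend on the basis. -/
def IsTraceClass {H : Type} [NormedAddCommGroup H] [InnerProductSpace ℂ H]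
    (A : H →L[ℂ] H) : Prop := ∃ t, HasOpTrace A t

open Classical in
/-- The trace of a trace class operator (and `0` for other operators). -/
def opTrace {H : Type} [NormedAddCommGroup H] [InnerProductSpace ℂ H] (A : H →L[ℂ] H) : ℂ :=
  if h : IsTraceClass A then h.choose else 0

/-- The positive square root of a positive bounded operator. -/
def opSqrt {H : Type} [NormedAddCommGroup H] [InnerProductSpace ℂ H] [CompleteSpace H]
    (A : H →L[ℂ] H) : H →L[ℂ] H := CFC.sqrt A

/-! ### One particle in the box -/

/-- The box `[-L/2, L/2]^d`. -/
abbrev Box (d : ℕ) (L : ℝ) : Type :=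
  Set.Icc (fun _ : Fin d => -(L / 2)) (fun _ : Fin d => L / 2)

/-- Lebesgue measure on the box. -/
instance measureSpace_box (d : ℕ) (L : ℝ) : MeasureSpace (Box d L) := Measure.Subtype.measureSpace

instance isFiniteMeasure_box (d : ℕ) (L : ℝ) : IsFiniteMeasure (volume : Measure (Box d L)) where
  measure_univ_lt_top := by
    have h : (volume : Measure (Box d L)) Set.univ =
        volume (Set.Icc (fun _ : Fin d => -(L / 2)) (fun _ : Fin d => L / 2)) :=
      Measure.Subtype.volume_univ measurableSet_Icc.nullMeasurableSet
    rw [h]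
    exact isCompact_Icc.measure_lt_top

/-- The one-particle space `L²` of the box with Lebesgue measure. -/
abbrev H1 (d : ℕ) (L : ℝ) : Type := Lp ℂ 2 (volume : Measure (Box d L))

/-- `|q|²` for the momentum `q = 2πk/L`. -/
def momentumSq {d : ℕ} (L : ℝ) (k : Fin d → ℤ) : ℝ := ∑ j, (2 * Real.pi * (k j : ℝ) / L) ^ 2

/-- The normalized plane wave `x ↦ L^{-d/2} exp(i q·x)` with momentum `q = 2πk/L`. -/
def planeWave (d : ℕ) (L : ℝ) (k : Fin d → ℤ) : C(Box d L, ℂ) where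
  toFun x := ((Real.sqrt (L ^ d))⁻¹ : ℂ) *
    Complex.exp (Complex.I * ((∑ j, (2 * Real.pi * (k j : ℝ) / L) * x.1 j : ℝ) : ℂ))
  continuous_toFun := by
    refine continuous_const.mul (Complex.continuous_exp.comp (continuous_const.mul
      (Complex.continuous_ofReal.comp (continuous_finsetSum _ fun j _ => ?_))))
    exact continuous_const.mul ((continuous_apply j).comp continuous_subtype_val)

/-- The plane waves as vectors of `L²`. They form the orthonormal basis of eigenvectors of the
Laplacian with periodic boundary conditions, with eigenvalues `-|q|²`. -/
def planeWaveLp (d : ℕ) (L : ℝ) (k : Fin d → ℤ) : H1 d L :=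
  ContinuousMap.toLp (E := ℂ) 2 volume ℂ (planeWave d L k)

/-- The heat operator `G_L = exp(β Δ_L)`, where `Δ_L` is the self-adjoint Laplacian of the box with
periodic boundary conditions, through the spectral decomposition of `Δ_L`:
`G_L = ∑_k exp(-β |q_k|²) ⟨e_k, ·⟩ e_k` (the series converges absolutely in operator norm). -/
def heatOp (d : ℕ) (L β : ℝ) : H1 d L →L[ℂ] H1 d L :=
  ∑' k : Fin d → ℤ, (Real.exp (-β * momentumSq L k) : ℂ) •
    InnerProductSpace.rankOne ℂ (planeWaveLp d L k) (planeWaveLp d L k)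

/-- Multiplication by a continuous function, as a bounded operator on `L²`. -/
def mulOp {d : ℕ} {L : ℝ} (g : C(Box d L, ℂ)) : H1 d L →L[ℂ] H1 d L :=
  (ContinuousLinearMap.mul ℂ ℂ).holderL volume ∞ 2 2 (ContinuousMap.toLp (E := ℂ) ∞ volume ℂ g)

/-- The function `e^{-f}`. -/
def expNeg {d : ℕ} {L : ℝ} (f : C(Box d L, ℝ)) : C(Box d L, ℂ) where
  toFun x := (Real.exp (-(f x)) : ℂ)
  continuous_toFun := by fun_prop

/-- `G̃_L = G_L^{1/2} e^{-f} G_L^{1/2}`. -/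
def heatOpTilde {d : ℕ} {L : ℝ} (β : ℝ) (f : C(Box d L, ℝ)) : H1 d L →L[ℂ] H1 d L :=
  opSqrt (heatOp d L β) * mulOp (expNeg f) * opSqrt (heatOp d L β)

/-- `K` is a continuous integral kernel of the operator `A`. -/
def IsKernel {d : ℕ} {L : ℝ} (A : H1 d L →L[ℂ] H1 d L) (K : C(Box d L × Box d L, ℂ)) : Prop :=
  ∀ φ : H1 d L, A φ =ᵐ[volume] fun x => ∫ y, K (x, y) * φ y

open Classical in
/-- The continuous integral kernel `A(x, y)` of an operator that has one. -/
def kernel {d : ℕ} {L : ℝ} (A : H1 d L →L[ℂ] H1 d L) : C(Box d L × Box d L, ℂ) :=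
  if h : ∃ K, IsKernel A K then h.choose else 0

/-! ### `N` particles in the box -/

/-- The `N`-fold Hilbert space tensor power of the one-particle space, realized as `L²` of the
`N`-fold product of the box. -/
abbrev HN (d N : ℕ) (L : ℝ) : Type := Lp ℂ 2 (volume : Measure (Fin N → Box d L))

theorem memLp_tprod {d N : ℕ} {L : ℝ} (φ : Fin N → H1 d L) :
    MemLp (fun x : Fin N → Box d L => ∏ i, φ i (x i)) 2 volume := by
  have hm : AEStronglyMeasurable (fun x : Fin N → Box d L => ∏ i, φ i (x i)) volume := by
    refine Finset.aestronglyMeasurable_fun_prod _ fun i _ => ?_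
    exact (Lp.aestronglyMeasurable (φ i)).comp_quasiMeasurePreserving
      (Measure.quasiMeasurePreserving_eval _ i)
  rw [memLp_two_iff_integrable_sq_norm hm]
  have h : ∀ i, Integrable (fun y : Box d L => ‖φ i y‖ ^ 2) volume := fun i =>
    (memLp_two_iff_integrable_sq_norm (Lp.aestronglyMeasurable (φ i))).1 (Lp.memLp (φ i))
  have h2 := Integrable.fintype_prod (μ := fun _ : Fin N => (volume : Measure (Box d L))) h
  refine h2.congr (Filter.Eventually.of_forall fun x => ?_)
  simp [norm_prod, Finset.prod_pow]

/-- `φ₁ ⊗ ⋯ ⊗ φ_N`, i.e. the function `(x₁, …, x_N) ↦ φ₁(x₁) ⋯ φ_N(x_N)`. -/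
def tprod {d N : ℕ} {L : ℝ} (φ : Fin N → H1 d L) : HN d N L := (memLp_tprod φ).toLp _

/-- `B` is the tensor power `⊗^N A`: it is bounded and maps `φ₁ ⊗ ⋯ ⊗ φ_N` to
`Aφ₁ ⊗ ⋯ ⊗ Aφ_N`. -/
def IsTensorPower {d N : ℕ} {L : ℝ} (A : H1 d L →L[ℂ] H1 d L) (B : HN d N L →L[ℂ] HN d N L) :
    Prop := ∀ φ : Fin N → H1 d L, B (tprod φ) = tprod fun i => A (φ i)

open Classical in
/-- The tensor power `⊗^N A` on the `N`-particle space. -/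
def tensorPower {d : ℕ} {L : ℝ} (N : ℕ) (A : H1 d L →L[ℂ] H1 d L) : HN d N L →L[ℂ] HN d N L :=
  if h : ∃ B : HN d N L →L[ℂ] HN d N L, IsTensorPower A B then h.choose else 0

theorem measurePreserving_perm {d N : ℕ} {L : ℝ} (σ : Sym N) :
    MeasurePreserving (fun (x : Fin N → Box d L) i => x (σ i)) volume volume := by
  have h := volume_preserving_arrowCongr' (α₁ := Fin N) (β₁ := Box d L) (α₂ := Fin N)
    (β₂ := Box d L) σ.symm (MeasurableEquiv.refl _) (MeasurePreserving.id _)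
  exact h

/-- The unitary `U(σ)`: `(U(σ) F)(x₁, …, x_N) = F(x_{σ(1)}, …, x_{σ(N)})`. -/
def permOp (d : ℕ) {N : ℕ} (L : ℝ) (σ : Sym N) : HN d N L →L[ℂ] HN d N L :=
  (Lp.compMeasurePreservingₗᵢ ℂ (fun (x : Fin N → Box d L) i => x (σ i))
    (measurePreserving_perm σ)).toContinuousLinearMap

/-- The linear extension of `U` to the group algebra. -/
def algOp (d : ℕ) {N : ℕ} (L : ℝ) (g : GrpAlg N) : HN d N L →L[ℂ] HN d N L :=
  ∑ σ : Sym N, g.coeff σ • permOp d L σ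

/-- `P_{pB} = ∑_T U(d(T))`. -/
def projPB (d : ℕ) {p N : ℕ} (L : ℝ) (T : ∀ μ : Frame p N, Tableau N μ.1) :
    HN d N L →L[ℂ] HN d N L := ∑ μ : Frame p N, algOp d L (dElt (T μ))

/-- The generating functional `E_{L,N}^{pF}[e^{-⟨f,ξ⟩}]` of `N` para-fermions of order `p`. -/
def genFunPF {d p N : ℕ} {L : ℝ} (β : ℝ) (f : C(Box d L, ℝ))
    (T : ∀ μ : Frame p N, Tableau N μ.1) : ℂ :=
  (∑ μ : Frame p N,
      opTrace (tensorPower N (heatOpTilde β f) * algOp d L (dElt (T μ).transpose))) /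
    (∑ μ : Frame p N,
      opTrace (tensorPower N (heatOp d L β) * algOp d L (dElt (T μ).transpose)))

/-- The generating functional `E_{L,N}^{pB}[e^{-⟨f,ξ⟩}]` of `N` para-bosons of order `p`. -/
def genFunPB {d p N : ℕ} {L : ℝ} (β : ℝ) (f : C(Box d L, ℝ))
    (T : ∀ μ : Frame p N, Tableau N μ.1) : ℂ :=
  opTrace (tensorPower N (heatOpTilde β f) * projPB d L T) /
    opTrace (tensorPower N (heatOp d L β) * projPB d L T)

end ParaStat

end

open ParaStat MeasureTheory

noncomputable section

namespace ParaStat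

open MeasureTheory
open scoped ENNReal BigOperators

/-! ### Row and column stabilizers -/

/-! For $A=G_L$ or $\tilde G_L$ put $\varphi_A(\sigma)=\mathrm{Tr}[(\otimes^N A)U(\sigma)]$. All
numerators and denominators are values of $\varphi_A$, extended linearly to the group algebra, so
the theorem splits into algebra, analysis and positivity.

Algebra. Relabelling momenta shows that $\varphi_A$ is a class function (`traceForm_conj`). For any
class function $\varphi$ one has $\sum_\sigma\chi_T(\sigma)\varphi(\sigma)=N!\,\varphi(d(T))$
(`sum_chi_mul`). Indeed the Young symmetrizer $c_T$ satisfies $c_T^2=\kappa c_T$, so right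
multiplication by $c_T$ is $\kappa$ on the left ideal. Hence $\kappa\chi_T(g)$ is the trace of
$x\mapsto g x c_T$ on the whole group algebra, which is read off from the coefficients of $c_T$. At
$g=1$ this gives $\kappa d_T=N!$. Finally $\varphi(e(T)a(T))=\varphi(a(T)e(T))=\varphi(e(T))$. The
factor $N!$ is the same above and below and cancels.

Analysis. Both operators send the plane waves to continuous functions with summable sup norms
(`IsSmoothing`). Hence $\otimes^N A$ is an absolutely convergent series of rank-one operators, its
products with $U(\sigma)$ have a basis-independent trace, and the kernel is a uniformly convergent
series. Termwise integration of $\prod_i A(x_i,x_{\sigma(i)})$ gives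
$\varphi_A(\sigma^{-1})=\varphi_A(\sigma)$, so the integrated immanant is the character sum.

Positivity. For the diagonal operator $G_L$, $\varphi_{G_L}$ is positive definite, strictly so
because there are momentum tuples with distinct entries (`sum_mul_traceForm_pos`). The number
$\varphi(c_T)$ is, up to a positive factor, the quadratic form of $\varphi$ with coefficients
$\mathrm{sgn}(\tau)$ at the distinct elements $\sigma\tau$. So $\varphi_{G_L}(d(T))>0$ for every
tableau, whatever its frame, and the denominators are sums of positive numbers over a nonempty set
of frames. -/

theorem eq_one_of_mem_rowStab_of_mem_colStab {N : ℕ} {μ : YoungDiagram} {T : Tableau N μ}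
    {σ : Sym N} (hr : σ ∈ rowStab T) (hc : σ ∈ colStab T) : σ = 1 := by
  ext i
  have : T (σ i) = T i := Subtype.ext (Prod.ext (hr i) (hc i))
  simpa using congrArg Fin.val (T.injective this)

theorem rowStab_mul_colStab_injective {N : ℕ} {μ : YoungDiagram} (T : Tableau N μ) :
    Function.Injective fun q : rowStab T × colStab T => (q.1 : Sym N) * (q.2 : Sym N) := by
  rintro ⟨r, c⟩ ⟨r', c'⟩ h
  have h' : (r : Sym N) * c = r' * c' := h
  have key : (r' : Sym N)⁻¹ * r = c' * (c : Sym N)⁻¹ := by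
    rw [inv_mul_eq_iff_eq_mul, ← mul_assoc, ← h', mul_assoc, mul_inv_cancel, mul_one]
  have h1 : (r' : Sym N)⁻¹ * r = 1 := eq_one_of_mem_rowStab_of_mem_colStab
    ((rowStab T).mul_mem ((rowStab T).inv_mem r'.2) r.2)
    (key ▸ (colStab T).mul_mem c'.2 ((colStab T).inv_mem c.2))
  have h2 : c' * (c : Sym N)⁻¹ = 1 := key ▸ h1
  refine Prod.ext (Subtype.ext ?_) (Subtype.ext ?_)
  · exact (inv_mul_eq_one.1 h1).symm
  · exact (mul_inv_eq_one.1 h2).symm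

/-- Among the sets of `m` natural numbers, `{0, …, m - 1}` has the smallest sum. -/
theorem sum_range_card_le_sum (s : Finset ℕ) : ∑ i ∈ Finset.range s.card, i ≤ ∑ i ∈ s, i := by
  induction s using Finset.induction_on_max with
  | empty => simp
  | insert a s ha ih =>
    have hn : a ∉ s := fun h => lt_irrefl _ (ha a h)
    have hc : s.card ≤ a := by
      simpa using Finset.card_le_card (fun x hx => Finset.mem_range.2 (ha x hx) : s ⊆ .range a)
    rw [Finset.card_insert_of_notMem hn, Finset.sum_range_succ, Finset.sum_insert hn]
    omega

/-- Only `{0, …, m - 1}` attains the smallest sum among the sets of `m` natural numbers. -/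
theorem eq_range_of_sum_le (s : Finset ℕ) (h : ∑ i ∈ s, i ≤ ∑ i ∈ Finset.range s.card, i) :
    s = Finset.range s.card := by
  induction s using Finset.induction_on_max with
  | empty => simp
  | insert a s ha ih =>
    have hn : a ∉ s := fun h => lt_irrefl _ (ha a h)
    have hc : s.card ≤ a := by
      simpa using Finset.card_le_card (fun x hx => Finset.mem_range.2 (ha x hx) : s ⊆ .range a)
    have h1 := sum_range_card_le_sum s
    rw [Finset.card_insert_of_notMem hn, Finset.sum_range_succ, Finset.sum_insert hn] at h
    have h2 : a = s.card := by omega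
    have h3 := ih (by omega)
    rw [Finset.card_insert_of_notMem hn, Finset.range_add_one, ← h3, ← h2]

/-- The entries in column `j` have the rows `0, …, μ.colLen j - 1`. -/
theorem image_row_filter_col {N : ℕ} {μ : YoungDiagram} (T : Tableau N μ) (j : ℕ) :
    (Finset.univ.filter fun i => (T i).1.2 = j).image (fun i => (T i).1.1) =
      Finset.range (μ.colLen j) := by
  ext r
  simp only [Finset.mem_image, Finset.mem_filter, Finset.mem_univ, true_and, Finset.mem_range,
    ← YoungDiagram.mem_iff_lt_colLen]
  constructor
  · rintro ⟨i, rfl, rfl⟩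
    exact (YoungDiagram.mem_cells _).1 (T i).2
  · intro h
    refine ⟨T.symm ⟨(r, j), (YoungDiagram.mem_cells _).2 h⟩, ?_, ?_⟩ <;> simp

/-- If a permutation moves the rows of a tableau transversally to its columns, then moving each
entry within its column to its old row stays inside of the frame. -/
theorem mem_cells_of_row_transversal {N : ℕ} {μ : YoungDiagram} (T : Tableau N μ) (g : Sym N)
    (hg : ∀ i j, (T (g i)).1.1 = (T (g j)).1.1 → (T i).1.2 = (T j).1.2 → i = j) (k : Fin N) :
    ((T (g k)).1.1, (T k).1.2) ∈ μ.cells := by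
  classical
  let C : ℕ → Finset (Fin N) := fun j => Finset.univ.filter fun i => (T i).1.2 = j
  let S : ℕ → Finset ℕ := fun j => (C j).image fun i => (T (g i)).1.1
  have hinj : ∀ j, Set.InjOn (fun i => (T (g i)).1.1) (C j) := by
    intro j a ha b hb hab
    simp only [C, Finset.coe_filter, Finset.mem_univ, true_and, Set.mem_ofPred_eq] at ha hb
    exact hg a b hab (ha.trans hb.symm)
  have hinj' : ∀ j, Set.InjOn (fun i => (T i).1.1) (C j) := by
    intro j a ha b hb hab
    simp only [C, Finset.coe_filter, Finset.mem_univ, true_and, Set.mem_ofPred_eq] at ha hb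
    exact T.injective (Subtype.ext (Prod.ext hab (ha.trans hb.symm)))
  have hCcard : ∀ j, (C j).card = μ.colLen j := by
    intro j
    rw [← Finset.card_image_of_injOn (hinj' j), image_row_filter_col, Finset.card_range]
  have hcard : ∀ j, (S j).card = μ.colLen j := by
    intro j
    rw [Finset.card_image_of_injOn (hinj j), hCcard]
  -- The total of the row indices is invariant under `g`. Within column `j` the new rows are
  -- `μ.colLen j` distinct numbers, so their sum is at least that of the old rows `0, …, μ.colLen j
  -- - 1`. Equal totals force equality in every column, hence equality of the sets of rows.
  have hsum : ∑ i, (T (g i)).1.1 = ∑ i, (T i).1.1 := Equiv.sum_comp g (fun i => (T i).1.1)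
  let J : Finset ℕ := Finset.univ.image fun i => (T i).1.2
  have hfib : ∀ F : Fin N → ℕ, ∑ i, F i = ∑ j ∈ J, ∑ i ∈ C j, F i := fun F =>
    (Finset.sum_fiberwise_of_maps_to (fun i _ => Finset.mem_image_of_mem _ (Finset.mem_univ i))
      F).symm
  have h1 : ∀ j, ∑ i ∈ C j, (T (g i)).1.1 = ∑ r ∈ S j, r := fun j =>
    (Finset.sum_image (f := id) (hinj j)).symm
  have h2 : ∀ j, ∑ i ∈ C j, (T i).1.1 = ∑ r ∈ Finset.range (S j).card, r := fun j => by
    rw [hcard, ← image_row_filter_col T j]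
    exact (Finset.sum_image (f := id) (hinj' j)).symm
  rw [hfib, hfib, Finset.sum_congr rfl fun j _ => h1 j, Finset.sum_congr rfl fun j _ => h2 j]
    at hsum
  have heq := (Finset.sum_eq_sum_iff_of_le fun j _ => sum_range_card_le_sum (S j)).1 hsum.symm
  have hk : (T k).1.2 ∈ J := Finset.mem_image_of_mem _ (Finset.mem_univ k)
  have hS := eq_range_of_sum_le _ (heq _ hk).ge
  have hmem : (T (g k)).1.1 ∈ S (T k).1.2 :=
    Finset.mem_image_of_mem (fun i => (T (g i)).1.1) (by simp [C])
  rw [hS, hcard, Finset.mem_range, ← YoungDiagram.mem_iff_lt_colLen] at hmem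
  exact (YoungDiagram.mem_cells _).2 hmem

/-- A permutation that moves the columns of a tableau transversally to its rows is the product of
a row and a column permutation. -/
theorem exists_eq_mul_of_transversal {N : ℕ} {μ : YoungDiagram} (T : Tableau N μ) (g : Sym N)
    (hg : ∀ i j, (T (g i)).1.1 = (T (g j)).1.1 → (T i).1.2 = (T j).1.2 → i = j) :
    ∃ r ∈ rowStab T, ∃ c ∈ colStab T, g = r * c := by
  -- The column factor must send `k` to the box in the column of `k` and the row of `g k`; what
  -- remains of `g` then preserves rows.
  let c₀ : Fin N → Fin N := fun k =>
    T.symm ⟨((T (g k)).1.1, (T k).1.2), mem_cells_of_row_transversal T g hg k⟩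
  have hT : ∀ k, (T (c₀ k)).1 = ((T (g k)).1.1, (T k).1.2) := fun k => by simp [c₀]
  have hinj : Function.Injective c₀ := by
    intro i j hij
    have h := congrArg (fun k => (T k).1) hij
    simp only [hT, Prod.mk.injEq] at h
    exact hg i j h.1 h.2
  let c : Sym N := Equiv.ofBijective c₀ (Finite.injective_iff_bijective.1 hinj)
  have hc : ∀ k, c k = c₀ k := fun _ => rfl
  refine ⟨g * c⁻¹, fun i => ?_, c, fun i => ?_, by simp⟩
  · obtain ⟨k, rfl⟩ := c.surjective i
    rw [Equiv.Perm.mul_apply, show c⁻¹ (c k) = k from c.symm_apply_apply k, hc, hT]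
  · rw [hc, hT]

/-! ### The Young symmetrizer -/

open Classical in
/-- The sum of the row stabilizer. -/
def rowSum {N : ℕ} {μ : YoungDiagram} (T : Tableau N μ) : GrpAlg N :=
  ∑ σ : rowStab T, MonoidAlgebra.of ℂ (Sym N) σ

open Classical in
/-- The alternating sum of the column stabilizer. -/
def colSum {N : ℕ} {μ : YoungDiagram} (T : Tableau N μ) : GrpAlg N :=
  ∑ τ : colStab T, sgn (τ : Sym N) • MonoidAlgebra.of ℂ (Sym N) τ

theorem sgn_mul {N : ℕ} (σ τ : Sym N) : sgn (σ * τ) = sgn σ * sgn τ := by simp [sgn]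

theorem sgn_inv {N : ℕ} (σ : Sym N) : sgn σ⁻¹ = sgn σ := by simp [sgn]

theorem sgn_mul_self {N : ℕ} (σ : Sym N) : sgn σ * sgn σ = 1 := by
  rw [← sgn_mul]; simp [sgn]

theorem star_sgn {N : ℕ} (σ : Sym N) : (starRingEnd ℂ) (sgn σ) = sgn σ := by simp [sgn]

theorem youngSym_eq {N : ℕ} {μ : YoungDiagram} (T : Tableau N μ) :
    youngSym T = rowSum T * colSum T := by
  simp only [youngSym, rowSum, colSum, Finset.sum_mul, Finset.mul_sum, map_mul, mul_smul_comm,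
    Finset.smul_sum]
  exact Finset.sum_comm

theorem rowSum_mul_of {N : ℕ} {μ : YoungDiagram} (T : Tableau N μ) {r : Sym N}
    (hr : r ∈ rowStab T) : rowSum T * MonoidAlgebra.of ℂ (Sym N) r = rowSum T := by
  classical
  simp only [rowSum, Finset.sum_mul, ← map_mul]
  exact Equiv.sum_comp (Equiv.mulRight (⟨r, hr⟩ : rowStab T))
    (fun σ : rowStab T => MonoidAlgebra.of ℂ (Sym N) (σ : Sym N))

theorem of_mul_rowSum {N : ℕ} {μ : YoungDiagram} (T : Tableau N μ) {r : Sym N}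
    (hr : r ∈ rowStab T) : MonoidAlgebra.of ℂ (Sym N) r * rowSum T = rowSum T := by
  classical
  simp only [rowSum, Finset.mul_sum, ← map_mul]
  exact Equiv.sum_comp (Equiv.mulLeft (⟨r, hr⟩ : rowStab T))
    (fun σ : rowStab T => MonoidAlgebra.of ℂ (Sym N) (σ : Sym N))

theorem of_mul_colSum {N : ℕ} {μ : YoungDiagram} (T : Tableau N μ) {c : Sym N}
    (hc : c ∈ colStab T) : MonoidAlgebra.of ℂ (Sym N) c * colSum T = sgn c • colSum T := by
  classical
  simp only [colSum, Finset.mul_sum, Finset.smul_sum, mul_smul_comm, ← map_mul]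
  refine Eq.trans ?_ (Equiv.sum_comp (Equiv.mulLeft (⟨c, hc⟩ : colStab T)) _)
  refine Finset.sum_congr rfl fun τ _ => ?_
  rw [Equiv.coe_mulLeft, Subgroup.coe_mul, sgn_mul, smul_smul, ← mul_assoc, sgn_mul_self, one_mul]

/-- Von Neumann's dichotomy: either `g` factors as row times column permutation and is absorbed up
to a sign, or two entries of one column are sent to one row, and the corresponding transpositions
make the product vanish. -/
theorem exists_rowSum_mul_of_mul_colSum {N : ℕ} {μ : YoungDiagram} (T : Tableau N μ) (g : Sym N) :
    ∃ z : ℂ, rowSum T * MonoidAlgebra.of ℂ (Sym N) g * colSum T = z • youngSym T := by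
  by_cases hg : ∀ i j, (T (g i)).1.1 = (T (g j)).1.1 → (T i).1.2 = (T j).1.2 → i = j
  · obtain ⟨r, hr, c, hc, rfl⟩ := exists_eq_mul_of_transversal T g hg
    refine ⟨sgn c, ?_⟩
    rw [map_mul, ← mul_assoc, rowSum_mul_of T hr, mul_assoc, of_mul_colSum T hc, mul_smul_comm,
      youngSym_eq]
  · push Not at hg
    obtain ⟨i, j, hrow, hcol, hij⟩ := hg
    refine ⟨0, ?_⟩
    have hr : Equiv.swap (g i) (g j) ∈ rowStab T := by
      intro k
      by_cases h1 : k = g i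
      · subst h1; simp [hrow]
      by_cases h2 : k = g j
      · subst h2; simp [hrow]
      rw [Equiv.swap_apply_of_ne_of_ne h1 h2]
    have hc : Equiv.swap i j ∈ colStab T := by
      intro k
      by_cases h1 : k = i
      · subst h1; simp [hcol]
      by_cases h2 : k = j
      · subst h2; simp [hcol]
      rw [Equiv.swap_apply_of_ne_of_ne h1 h2]
    have hcomm : Equiv.swap (g i) (g j) * g = g * Equiv.swap i j := by
      rw [Equiv.mul_swap_eq_swap_mul]
    have hs : sgn (Equiv.swap i j) = -1 := by simp [sgn, Equiv.Perm.sign_swap hij]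
    -- The row sum absorbs the transposition of `g i` and `g j`; moved past `g` it becomes that of
    -- `i` and `j`, and the column sum turns it into `-1`.
    have h : rowSum T * MonoidAlgebra.of ℂ (Sym N) g * colSum T =
        -(rowSum T * MonoidAlgebra.of ℂ (Sym N) g * colSum T) := by
      conv_lhs => rw [← rowSum_mul_of T hr, mul_assoc (rowSum T), ← map_mul, hcomm, map_mul,
        ← mul_assoc, mul_assoc _ _ (colSum T), of_mul_colSum T hc, hs, neg_one_smul, mul_neg]
    rw [zero_smul]
    have h2 : (2 : ℂ) • (rowSum T * MonoidAlgebra.of ℂ (Sym N) g * colSum T) = 0 := by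
      rw [two_smul]; nth_rewrite 1 [h]; exact neg_add_cancel _
    exact (smul_eq_zero.1 h2).resolve_left two_ne_zero

/-- The Young symmetrizer is idempotent up to a factor. -/
theorem exists_youngSym_mul_self {N : ℕ} {μ : YoungDiagram} (T : Tableau N μ) :
    ∃ κ : ℂ, youngSym T * youngSym T = κ • youngSym T := by
  suffices h : ∀ x : GrpAlg N, ∃ z : ℂ, rowSum T * x * colSum T = z • youngSym T by
    obtain ⟨z, hz⟩ := h (colSum T * rowSum T)
    refine ⟨z, ?_⟩
    rw [← hz, youngSym_eq]
    simp only [mul_assoc]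
  intro x
  induction x using MonoidAlgebra.induction_on with
  | of g => exact exists_rowSum_mul_of_mul_colSum T g
  | add x y hx hy =>
    obtain ⟨a, ha⟩ := hx
    obtain ⟨b, hb⟩ := hy
    exact ⟨a + b, by rw [mul_add, add_mul, ha, hb, add_smul]⟩
  | smul r x hx =>
    obtain ⟨a, ha⟩ := hx
    exact ⟨r * a, by rw [mul_smul_comm, smul_mul_assoc, ha, smul_smul]⟩

/-! ### Irreducible characters and class functions on the group algebra -/

theorem trace_grpAlg {N : ℕ} (F : GrpAlg N →ₗ[ℂ] GrpAlg N) :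
    LinearMap.trace ℂ (GrpAlg N) F =
      ∑ x : Sym N, (F (MonoidAlgebra.of ℂ (Sym N) x)).coeff x := by
  classical
  let b : Module.Basis (Sym N) ℂ (GrpAlg N) :=
    Module.Basis.ofRepr (MonoidAlgebra.coeffLinearEquiv ℂ)
  rw [LinearMap.trace_eq_matrix_trace ℂ b, Matrix.trace]
  refine Finset.sum_congr rfl fun x _ => ?_
  rw [Matrix.diag_apply, LinearMap.toMatrix_apply]
  rfl

/-- The linear extension of a function on the group to the group algebra. -/
def evalAt {N : ℕ} (φ : Sym N → ℂ) : GrpAlg N →ₗ[ℂ] ℂ where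
  toFun g := ∑ σ, g.coeff σ * φ σ
  map_add' x y := by simp [add_mul, Finset.sum_add_distrib]
  map_smul' r x := by simp [Finset.mul_sum, mul_assoc]

theorem evalAt_apply {N : ℕ} (φ : Sym N → ℂ) (g : GrpAlg N) :
    evalAt φ g = ∑ σ, g.coeff σ * φ σ := rfl

theorem evalAt_of {N : ℕ} (φ : Sym N → ℂ) (σ : Sym N) :
    evalAt φ (MonoidAlgebra.of ℂ (Sym N) σ) = φ σ := by
  classical
  simp [evalAt_apply, Finsupp.single_apply]

open Classical in
theorem evalAt_youngSym {N : ℕ} {μ : YoungDiagram} (T : Tableau N μ) (φ : Sym N → ℂ) :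
    evalAt φ (youngSym T) =
      ∑ q : rowStab T × colStab T, sgn (q.2 : Sym N) * φ ((q.1 : Sym N) * (q.2 : Sym N)) := by
  simp only [youngSym, map_sum, map_smul, evalAt_of, smul_eq_mul, Fintype.sum_prod_type]

/-- The products `r * c` are pairwise distinct, so only `(1, 1)` contributes to the identity. -/
theorem youngSym_coeff_one {N : ℕ} {μ : YoungDiagram} (T : Tableau N μ) :
    (youngSym T).coeff 1 = 1 := by
  classical
  have h := evalAt_youngSym T (Pi.single 1 1)
  rw [evalAt_apply, Finset.sum_eq_single 1 (fun b _ hb => by simp [hb]) (by simp),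
    Finset.sum_eq_single 1] at h
  · simpa [sgn] using h
  · intro q _ hq
    rw [Pi.single_eq_of_ne, mul_zero]
    intro h1
    exact hq (rowStab_mul_colStab_injective T (by simpa using h1))
  · simp

/-- A class function does not see the order of the factors. -/
theorem evalAt_mul_comm {N : ℕ} {φ : Sym N → ℂ} (hφ : ∀ σ τ, φ (τ * σ * τ⁻¹) = φ σ)
    (x y : GrpAlg N) : evalAt φ (x * y) = evalAt φ (y * x) := by
  induction x using MonoidAlgebra.induction_on with
  | of g =>
    induction y using MonoidAlgebra.induction_on with
    | of h =>
      rw [← map_mul, ← map_mul, evalAt_of, evalAt_of, ← hφ (g * h) h]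
      congr 1
      group
    | add x y hx hy => rw [mul_add, add_mul, map_add, map_add, hx, hy]
    | smul r x hx => rw [mul_smul_comm, smul_mul_assoc, map_smul, map_smul, hx]
  | add x y hx hy => rw [mul_add, add_mul, map_add, map_add, hx, hy]
  | smul r x hx => rw [mul_smul_comm, smul_mul_assoc, map_smul, map_smul, hx]

/-- Combined with the trace property of class functions, this makes $d(T)$ and $e(T)$
indistinguishable to them. -/
theorem rowSym_mul_youngSym {N : ℕ} {μ : YoungDiagram} (T : Tableau N μ) :
    rowSym T * youngSym T = youngSym T := by
  classical
  have h : rowSum T * rowSum T = (Nat.card (rowStab T) : ℂ) • rowSum T := by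
    conv_lhs => enter [1]; rw [rowSum]
    rw [Finset.sum_mul, Finset.sum_congr rfl fun r _ => of_mul_rowSum T r.2, Finset.sum_const,
      Finset.card_univ, Nat.card_eq_fintype_card, Nat.cast_smul_eq_nsmul]
  have h0 : (Nat.card (rowStab T) : ℂ) ≠ 0 := Nat.cast_ne_zero.2 Nat.card_pos.ne'
  change ((Nat.card (rowStab T) : ℂ)⁻¹ • rowSum T) * youngSym T = _
  rw [youngSym_eq, smul_mul_assoc, ← mul_assoc, h, smul_mul_assoc, smul_smul, inv_mul_cancel₀ h0,
    one_smul]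

theorem mul_youngSym_mem_irrep {N : ℕ} {μ : YoungDiagram} (T : Tableau N μ) (x : GrpAlg N) :
    x * youngSym T ∈ irrep T := by
  rw [← smul_eq_mul]
  exact Submodule.smul_mem _ _ (Submodule.mem_span_singleton_self _)

/-- Right multiplication with the Young symmetrizer, as a map onto the left ideal. -/
def mulYoungSym {N : ℕ} {μ : YoungDiagram} (T : Tableau N μ) : GrpAlg N →ₗ[ℂ] irrep T where
  toFun x := ⟨x * youngSym T, mul_youngSym_mem_irrep T x⟩
  map_add' x y := Subtype.ext (add_mul x y _)
  map_smul' r x := Subtype.ext (smul_mul_assoc r x _)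

/-- Right multiplication by $c_T$ maps the group algebra into the ideal and acts there as $\kappa$.
By cyclicity the trace of $\kappa\rho(g)$ on the ideal is that of $x\mapsto g x c_T$ on the group
algebra, whose diagonal entry at $x$ is the coefficient of $c_T$ at $x^{-1}g^{-1}x$. -/
theorem mul_chi {N : ℕ} {μ : YoungDiagram} (T : Tableau N μ) {κ : ℂ}
    (hκ : youngSym T * youngSym T = κ • youngSym T) (g : Sym N) :
    κ * chi T g = ∑ x : Sym N, (youngSym T).coeff (x⁻¹ * g⁻¹ * x) := by
  let ρ : irrep T →ₗ[ℂ] irrep T := Representation.ofModule' (k := ℂ) (G := Sym N) (irrep T) g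
  let incl : irrep T →ₗ[ℂ] GrpAlg N := (irrep T).subtype.restrictScalars ℂ
  have hρ : ∀ v : irrep T, ((ρ v : irrep T) : GrpAlg N) = MonoidAlgebra.of ℂ (Sym N) g * v := by
    intro v
    rw [← smul_eq_mul, ← Submodule.coe_smul]
    rfl
  have h1 : (mulYoungSym T) ∘ₗ (incl ∘ₗ ρ) = κ • ρ := by
    refine LinearMap.ext fun v => Subtype.ext ?_
    obtain ⟨v, hv⟩ := v
    obtain ⟨w, rfl⟩ := Submodule.mem_span_singleton.1 hv
    change (((ρ ⟨w • youngSym T, hv⟩ : irrep T) : GrpAlg N) * youngSym T) =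
      κ • ((ρ ⟨w • youngSym T, hv⟩ : irrep T) : GrpAlg N)
    rw [hρ]
    change MonoidAlgebra.of ℂ (Sym N) g * (w * youngSym T) * youngSym T =
      κ • (MonoidAlgebra.of ℂ (Sym N) g * (w * youngSym T))
    rw [mul_assoc, mul_assoc, hκ, mul_smul_comm, mul_smul_comm]
  have h2 := LinearMap.trace_comp_comm' (R := ℂ) (incl ∘ₗ ρ) (mulYoungSym T)
  rw [h1, map_smul, smul_eq_mul, trace_grpAlg] at h2
  refine h2.trans (Finset.sum_congr rfl fun x _ => ?_)
  change ((ρ (mulYoungSym T (MonoidAlgebra.of ℂ (Sym N) x)) : irrep T) : GrpAlg N).coeff x = _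
  rw [hρ]
  change (MonoidAlgebra.of ℂ (Sym N) g * (MonoidAlgebra.of ℂ (Sym N) x * youngSym T)).coeff x = _
  rw [← mul_assoc, ← map_mul, MonoidAlgebra.of_apply, MonoidAlgebra.coeff_single_mul_apply]
  simp [mul_assoc]

theorem mul_irrepDim {N : ℕ} {μ : YoungDiagram} (T : Tableau N μ) {κ : ℂ}
    (hκ : youngSym T * youngSym T = κ • youngSym T) : κ * irrepDim T = N.factorial := by
  have h := mul_chi T hκ 1
  have h1 : chi T 1 = irrepDim T := Representation.char_one _
  rw [h1] at h
  rw [h]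
  simp [youngSym_coeff_one, Fintype.card_perm]

/-- A permutation and its inverse have the same cycle type. This removes the inverses that the
character formula and the kernel integrals produce. -/
theorem class_fun_inv {N : ℕ} {φ : Sym N → ℂ} (hφ : ∀ σ τ, φ (τ * σ * τ⁻¹) = φ σ) (σ : Sym N) :
    φ σ⁻¹ = φ σ := by
  have h : IsConj σ σ⁻¹ := Equiv.Perm.isConj_iff_cycleType_eq.2 (Equiv.Perm.cycleType_inv σ).symm
  obtain ⟨τ, hτ⟩ := isConj_iff.1 h
  rw [← hτ, hφ]

theorem evalAt_dElt_eq {N : ℕ} {μ : YoungDiagram} (T : Tableau N μ) {φ : Sym N → ℂ}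
    (hφ : ∀ σ τ, φ (τ * σ * τ⁻¹) = φ σ) :
    evalAt φ (dElt T) = (irrepDim T : ℂ) / N.factorial * evalAt φ (youngSym T) := by
  rw [dElt, evalAt_mul_comm hφ, eElt, mul_smul_comm, rowSym_mul_youngSym, map_smul, smul_eq_mul]

/-- Pairing a class function with an irreducible character is evaluating it, up to a factor `N!`,
at the corresponding `d(T)`. -/
theorem sum_chi_mul {N : ℕ} {μ : YoungDiagram} (T : Tableau N μ) {φ : Sym N → ℂ}
    (hφ : ∀ σ τ, φ (τ * σ * τ⁻¹) = φ σ) :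
    ∑ σ, chi T σ * φ σ = N.factorial * evalAt φ (dElt T) := by
  obtain ⟨κ, hκ⟩ := exists_youngSym_mul_self T
  have hN : (N.factorial : ℂ) ≠ 0 := Nat.cast_ne_zero.2 N.factorial_ne_zero
  have hd := mul_irrepDim T hκ
  have hκ0 : κ ≠ 0 := fun h => hN (by rw [← hd, h, zero_mul])
  rw [evalAt_dElt_eq T hφ]
  apply mul_left_cancel₀ hκ0
  have h : κ * ∑ σ, chi T σ * φ σ = N.factorial * evalAt φ (youngSym T) := by
    rw [Finset.mul_sum]
    simp only [← mul_assoc, mul_chi T hκ, Finset.sum_mul]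
    rw [Finset.sum_comm]
    -- Substituting $\sigma\mapsto x^{-1}\sigma^{-1}x$ leaves `φ` unchanged, so each of the $N!$
    -- values of `x` contributes equally.
    have hx : ∀ x : Sym N, ∑ σ, (youngSym T).coeff (x⁻¹ * σ⁻¹ * x) * φ σ =
        evalAt φ (youngSym T) := by
      intro x
      rw [evalAt_apply]
      refine Eq.trans ?_
        (Equiv.sum_comp ((Equiv.inv (Sym N)).trans (MulAut.conj x⁻¹).toEquiv) _)
      refine Finset.sum_congr rfl fun σ _ => ?_
      simp only [Equiv.trans_apply, Equiv.inv_apply, MulEquiv.toEquiv_eq_coe, EquivLike.coe_coe,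
        MulAut.conj_apply, inv_inv]
      congr 1
      rw [← class_fun_inv hφ σ]
      simpa using (hφ σ⁻¹ x⁻¹).symm
    rw [Finset.sum_congr rfl fun x _ => hx x, Finset.sum_const, Finset.card_univ,
      Fintype.card_perm, Fintype.card_fin, nsmul_eq_mul]
  rw [h, ← hd]
  field_simp

open Classical in
/-- The value of a class function at a Young symmetrizer as a quadratic form. -/
theorem card_mul_evalAt_youngSym {N : ℕ} {μ : YoungDiagram} (T : Tableau N μ) {φ : Sym N → ℂ}
    (hφ : ∀ σ τ, φ (τ * σ * τ⁻¹) = φ σ) :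
    (Fintype.card (rowStab T × colStab T) : ℂ) * evalAt φ (youngSym T) =
      ∑ q' : rowStab T × colStab T, ∑ q : rowStab T × colStab T,
        sgn (q.2 : Sym N) * sgn (q'.2 : Sym N) *
          φ (((q.1 : Sym N) * q.2) * ((q'.1 : Sym N) * q'.2)⁻¹) := by
  have h : ∀ q' : rowStab T × colStab T, ∑ q : rowStab T × colStab T,
      sgn (q.2 : Sym N) * sgn (q'.2 : Sym N) *
        φ (((q.1 : Sym N) * q.2) * ((q'.1 : Sym N) * q'.2)⁻¹) = evalAt φ (youngSym T) := by
    intro q'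
    rw [evalAt_youngSym]
    -- For fixed $(r',c')$ the element $rc(r'c')^{-1}$ is conjugate by $r'$ to
    -- $(r'^{-1}r)(cc'^{-1})$, again a row times a column permutation.
    refine Eq.trans ?_ (Equiv.sum_comp
      ((Equiv.mulLeft q'.1⁻¹).prodCongr (Equiv.mulRight q'.2⁻¹)) _)
    refine Finset.sum_congr rfl fun q _ => ?_
    simp only [Equiv.prodCongr_apply, Prod.map_fst, Prod.map_snd, Equiv.coe_mulLeft,
      Equiv.coe_mulRight, Subgroup.coe_mul, Subgroup.coe_inv, sgn_mul, sgn_inv]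
    congr 1
    rw [← hφ ((q'.1 : Sym N)⁻¹ * q.1 * (q.2 * (q'.2 : Sym N)⁻¹)) q'.1]
    congr 1
    group
  rw [Finset.sum_congr rfl fun q' _ => h q', Finset.sum_const, Finset.card_univ, nsmul_eq_mul]

/-! ### Fourier series on the box -/

/-- The normalized Haar measure of the torus. -/
def torusMeasure (ι : Type) [Fintype ι] : Measure (UnitAddTorus ι) :=
  Measure.pi fun _ => AddCircle.haarAddCircle

theorem ae_eq_zero_of_forall_mFourier {ι : Type} [Fintype ι] {g : UnitAddTorus ι → ℂ}
    (hg : MemLp g 2 (torusMeasure ι))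
    (h : ∀ n, ∫ t, (starRingEnd ℂ) (UnitAddTorus.mFourier n t) * g t ∂torusMeasure ι = 0) :
    g =ᵐ[torusMeasure ι] 0 := by
  -- This makes `volume` on the torus the normalized Haar measure, for which
  -- `UnitAddTorus.mFourierBasis` is used.
  let _ : MeasureSpace UnitAddCircle := ⟨AddCircle.haarAddCircle⟩
  have hg' : MemLp g 2 (volume : Measure (UnitAddTorus ι)) := hg
  have hz : hg'.toLp g = 0 := by
    apply UnitAddTorus.mFourierBasis.repr.injective
    rw [map_zero]
    ext n
    rw [UnitAddTorus.mFourierBasis_repr, UnitAddTorus.mFourierCoeff]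
    refine Eq.trans ?_ (h n)
    refine integral_congr_ae ?_
    filter_upwards [hg'.coeFn_toLp] with t ht
    rw [UnitAddTorus.mFourier_neg, smul_eq_mul, ht]
  have h1 := hg'.coeFn_toLp
  rw [hz] at h1
  exact h1.symm.trans (Lp.coeFn_zero _ _ _)

theorem integral_conj_mFourier_mul {ι : Type} [Fintype ι] [DecidableEq (ι → ℤ)] (m n : ι → ℤ) :
    ∫ t, (starRingEnd ℂ) (UnitAddTorus.mFourier m t) * UnitAddTorus.mFourier n t ∂torusMeasure ι =
      if m = n then 1 else 0 := by
  let _ : MeasureSpace UnitAddCircle := ⟨AddCircle.haarAddCircle⟩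
  have h := orthonormal_iff_ite.1 (UnitAddTorus.orthonormal_mFourier (d := ι)) m n
  rw [ContinuousMap.inner_toLp] at h
  rw [← h]
  simp only [mul_comm]
  rfl

section Section

variable {ι X : Type} [Fintype ι] [MeasurableSpace X] {μ : Measure X}
  {S : UnitAddTorus ι → X} {c : ℝ≥0∞}

theorem integral_comp_section (hS : MeasurePreserving S (torusMeasure ι) (c • μ))
    {F : X → ℂ} (hF : AEStronglyMeasurable F μ) :
    ∫ t, F (S t) ∂torusMeasure ι = c.toReal • ∫ x, F x ∂μ := by
  rw [← integral_smul_measure, ← hS.map_eq, integral_map hS.aemeasurable]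
  rw [hS.map_eq]
  exact hF.smul_measure c

/-- If a map from the torus is measure preserving up to a factor and pulls back a family of
functions to multiples of the Fourier monomials, then the family is total. -/
theorem ae_eq_zero_of_section (hS : MeasurePreserving S (torusMeasure ι) (c • μ)) (hc : c ≠ 0)
    (hc' : c ≠ ∞) {κ : ℂ} (hκ : κ ≠ 0) {e : (ι → ℤ) → X → ℂ}
    (he : ∀ n, AEStronglyMeasurable (e n) μ)
    (heS : ∀ n t, e n (S t) = κ * UnitAddTorus.mFourier n t) {F : X → ℂ} (hF : MemLp F 2 μ)
    (h : ∀ n, ∫ x, (starRingEnd ℂ) (e n x) * F x ∂μ = 0) : F =ᵐ[μ] 0 := by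
  have hg : MemLp (F ∘ S) 2 (torusMeasure ι) :=
    (hF.smul_measure hc').comp_measurePreserving hS
  have h0 := ae_eq_zero_of_forall_mFourier hg fun n => by
    have h1 := integral_comp_section hS
      (F := fun x => (starRingEnd ℂ) (e n x) * F x)
      ((Complex.continuous_conj.comp_aestronglyMeasurable (he n)).mul hF.1)
    rw [h n, smul_zero] at h1
    simp only [heS, map_mul, mul_assoc] at h1
    rw [integral_const_mul] at h1
    exact (mul_eq_zero.1 h1).resolve_left (by simpa using hκ)
  have h2 : F =ᵐ[c • μ] 0 := by
    have hm : AEStronglyMeasurable F (c • μ) := hF.1.smul_measure c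
    rw [← hS.map_eq] at hm ⊢
    -- A strongly measurable representative has a measurable zero set, so its vanishing can be
    -- tested on the torus.
    obtain ⟨F', hF'm, hF'⟩ := hm
    have h3 : F' ∘ S =ᵐ[torusMeasure ι] 0 :=
      Filter.EventuallyEq.trans
        (Filter.EventuallyEq.symm (ae_of_ae_map hS.aemeasurable hF')) h0
    refine hF'.trans ?_
    exact (ae_map_iff hS.aemeasurable (hF'm.measurableSet_eq_fun stronglyMeasurable_const)).2 h3
  exact (Measure.ae_ennreal_smul_measure_iff hc).1 h2

theorem integral_conj_mul_of_section [DecidableEq (ι → ℤ)]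
    (hS : MeasurePreserving S (torusMeasure ι) (c • μ)) (hc : c ≠ 0)
    {κ : ℂ} (hκ : (starRingEnd ℂ) κ * κ = c.toReal) (hc' : c ≠ ∞) {e : (ι → ℤ) → X → ℂ}
    (he : ∀ n, AEStronglyMeasurable (e n) μ)
    (heS : ∀ n t, e n (S t) = κ * UnitAddTorus.mFourier n t) (m n : ι → ℤ) :
    ∫ x, (starRingEnd ℂ) (e m x) * e n x ∂μ = if m = n then 1 else 0 := by
  have h1 := integral_comp_section hS
    (F := fun x => (starRingEnd ℂ) (e m x) * e n x)
    ((Complex.continuous_conj.comp_aestronglyMeasurable (he m)).mul (he n))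
  have h2 : ∀ t, (starRingEnd ℂ) (e m (S t)) * e n (S t) = (c.toReal : ℂ) *
      ((starRingEnd ℂ) (UnitAddTorus.mFourier m t) * UnitAddTorus.mFourier n t) := by
    intro t
    rw [heS, heS, ← hκ, map_mul]
    ring
  simp only [h2] at h1
  rw [integral_const_mul, integral_conj_mFourier_mul, Complex.real_smul] at h1
  exact (mul_left_cancel₀ (Complex.ofReal_ne_zero.2 (ENNReal.toReal_ne_zero.2 ⟨hc, hc'⟩)) h1).symm

end Section

/-! ### The section of the covering of the torus by the box -/

theorem pi_const_smul {ι X : Type} [Fintype ι] [MeasurableSpace X] (ν : Measure X)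
    [IsFiniteMeasure ν] {c : ℝ≥0∞} (hc : c ≠ ∞) :
    Measure.pi (fun _ : ι => c • ν) = c ^ Fintype.card ι • Measure.pi fun _ : ι => ν := by
  have : IsFiniteMeasure (c • ν) := ν.smul_finite hc
  refine Measure.pi_eq fun s hs => ?_
  simp [Measure.pi_pi, Finset.prod_mul_distrib]

/-- The representative of a point of the circle in the interval `(-L/2, L/2]`. -/
def circleSection (L : ℝ) (t : UnitAddCircle) : ℝ := L * (AddCircle.equivIoc 1 (-(1 / 2)) t : ℝ)

theorem circleSection_mem {L : ℝ} (hL : 0 < L) (t : UnitAddCircle) :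
    circleSection L t ∈ Set.Ioc (-(L / 2)) (L / 2) := by
  have h := (AddCircle.equivIoc 1 (-(1 / 2) : ℝ) t).2
  simp only [Set.mem_Ioc] at h
  simp only [circleSection, Set.mem_Ioc]
  constructor <;> nlinarith [h.1, h.2]

theorem coe_circleSection_div {L : ℝ} (hL : 0 < L) (t : UnitAddCircle) :
    ((circleSection L t / L : ℝ) : UnitAddCircle) = t := by
  rw [circleSection, mul_div_cancel_left₀ _ hL.ne']
  exact (AddCircle.equivIoc 1 (-(1 / 2) : ℝ)).symm_apply_apply t

theorem measurePreserving_circleSection {L : ℝ} (hL : 0 < L) :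
    MeasurePreserving (circleSection L) AddCircle.haarAddCircle
      (ENNReal.ofReal L⁻¹ • volume.restrict (Set.Ioc (-(L / 2)) (L / 2))) := by
  have h1 := AddCircle.measurePreserving_equivIoc (1 : ℝ) (a := -(1 / 2))
  rw [AddCircle.volume_eq_smul_haarAddCircle, ENNReal.ofReal_one, one_smul] at h1
  have h2 := (measurePreserving_subtype_coe (μa := (volume : Measure ℝ))
    (measurableSet_Ioc (a := -(1 / 2 : ℝ)) (b := -(1 / 2) + 1))).comp h1
  have h3 : MeasurePreserving (fun x : ℝ => L * x) volume (ENNReal.ofReal L⁻¹ • volume) :=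
    ⟨measurable_const_mul L, by
      rw [Real.map_volume_mul_left hL.ne', abs_of_pos (inv_pos.2 hL)]⟩
  have h4 := h3.restrict_preimage (measurableSet_Ioc (a := -(L / 2)) (b := L / 2))
  have h5 : (fun x : ℝ => L * x) ⁻¹' Set.Ioc (-(L / 2)) (L / 2) =
      Set.Ioc (-(1 / 2)) (-(1 / 2) + 1) := by
    ext x
    simp only [Set.mem_preimage, Set.mem_Ioc]
    constructor <;> rintro ⟨ha, hb⟩ <;> constructor <;> nlinarith
  rw [h5, Measure.restrict_smul] at h4
  exact h4.comp h2

/-- The point of the box over a point of the torus. -/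
def boxSection (d : ℕ) {L : ℝ} (hL : 0 < L) (t : UnitAddTorus (Fin d)) : Box d L :=
  ⟨fun j => circleSection L (t j), fun j => (circleSection_mem hL (t j)).1.le,
    fun j => (circleSection_mem hL (t j)).2⟩

theorem measurePreserving_boxSection (d : ℕ) {L : ℝ} (hL : 0 < L) :
    MeasurePreserving (boxSection d hL) (torusMeasure (Fin d))
      (ENNReal.ofReal L⁻¹ ^ d • volume) := by
  have h1 : MeasurePreserving (fun (t : UnitAddTorus (Fin d)) j => circleSection L (t j))
      (torusMeasure (Fin d)) (ENNReal.ofReal L⁻¹ ^ d •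
        volume.restrict (Set.Icc (fun _ : Fin d => -(L / 2)) (fun _ : Fin d => L / 2))) := by
    have : IsFiniteMeasure (ENNReal.ofReal L⁻¹ •
        (volume : Measure ℝ).restrict (Set.Ioc (-(L / 2)) (L / 2))) :=
      Measure.smul_finite _ ENNReal.ofReal_ne_top
    have h := measurePreserving_pi (fun _ : Fin d => (AddCircle.haarAddCircle : Measure
      UnitAddCircle)) _ fun _ => measurePreserving_circleSection hL
    -- The section takes values in the half-open box, which differs from the closed one by a null
    -- set.
    rw [pi_const_smul _ ENNReal.ofReal_ne_top, Fintype.card_fin, ← Measure.restrict_pi_pi,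
      Measure.restrict_congr_set Measure.univ_pi_Ioc_ae_eq_Icc] at h
    exact h
  have hm : Measurable (boxSection d hL) := h1.measurable.subtype_mk
  refine ⟨hm, Measure.ext fun A hA => ?_⟩
  have hA' : MeasurableSet (Subtype.val '' A : Set (Fin d → ℝ)) :=
    measurableSet_Icc.subtype_image hA
  have hpre : boxSection d hL ⁻¹' A =
      (fun (t : UnitAddTorus (Fin d)) j => circleSection L (t j)) ⁻¹' (Subtype.val '' A) := by
    ext t
    simp only [Set.mem_preimage, Set.mem_image]
    constructor
    · intro h
      exact ⟨_, h, rfl⟩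
    · rintro ⟨x, hx, hxt⟩
      rwa [show boxSection d hL t = x from Subtype.ext hxt.symm]
  rw [Measure.map_apply hm hA, hpre, h1.measure_preimage hA'.nullMeasurableSet,
    Measure.smul_apply, Measure.smul_apply, Measure.restrict_apply hA',
    Set.inter_eq_left.2 (Subtype.coe_image_subset _ _)]
  congr 1
  exact (comap_subtype_coe_apply measurableSet_Icc volume A).symm

/-- Checked for the inverse map, under which a rectangle pulls back to a product of rectangles. -/
theorem measurePreserving_curry {ι κ X : Type} [Fintype ι] [Fintype κ] [MeasurableSpace X]
    (ν : Measure X) [IsFiniteMeasure ν] :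
    MeasurePreserving (fun (x : ι × κ → X) i j => x (i, j)) (Measure.pi fun _ => ν)
      (Measure.pi fun _ => Measure.pi fun _ => ν) := by
  have h : MeasurePreserving (MeasurableEquiv.curry ι κ X).symm
      (Measure.pi fun _ => Measure.pi fun _ => ν) (Measure.pi fun _ => ν) := by
    refine ⟨(MeasurableEquiv.curry ι κ X).symm.measurable, (Measure.pi_eq fun s hs => ?_).symm⟩
    rw [MeasurableEquiv.map_apply]
    have : (MeasurableEquiv.curry ι κ X).symm ⁻¹' Set.univ.pi s =
        Set.univ.pi fun i => Set.univ.pi fun j => s (i, j) := by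
      ext x
      simp [Set.mem_pi, MeasurableEquiv.curry, Function.uncurry]
    rw [this]
    simp [Measure.pi_pi, Fintype.prod_prod_type]
  exact h.symm

/-- The configuration of `N` points of the box over a point of the torus of dimension `N * d`. -/
def configSection (d N : ℕ) {L : ℝ} (hL : 0 < L) (t : UnitAddTorus (Fin N × Fin d)) :
    Fin N → Box d L := fun i => boxSection d hL fun j => t (i, j)

theorem measurePreserving_configSection (d N : ℕ) {L : ℝ} (hL : 0 < L) :
    MeasurePreserving (configSection d N hL) (torusMeasure (Fin N × Fin d))
      ((ENNReal.ofReal L⁻¹ ^ d) ^ N • volume) := by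
  have h1 := measurePreserving_curry (ι := Fin N) (κ := Fin d)
    (AddCircle.haarAddCircle : Measure UnitAddCircle)
  have : IsFiniteMeasure (ENNReal.ofReal L⁻¹ ^ d • (volume : Measure (Box d L))) :=
    Measure.smul_finite _ (ENNReal.pow_ne_top ENNReal.ofReal_ne_top)
  have : IsFiniteMeasure (torusMeasure (Fin d)) := by unfold torusMeasure; infer_instance
  have h2 := measurePreserving_pi (fun _ : Fin N => torusMeasure (Fin d)) _
    fun _ => measurePreserving_boxSection d hL
  rw [pi_const_smul _ (ENNReal.pow_ne_top ENNReal.ofReal_ne_top), Fintype.card_fin] at h2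
  exact h2.comp h1

theorem planeWave_boxSection (d : ℕ) {L : ℝ} (hL : 0 < L) (k : Fin d → ℤ)
    (t : UnitAddTorus (Fin d)) :
    planeWave d L k (boxSection d hL t) =
      ((Real.sqrt (L ^ d))⁻¹ : ℂ) * UnitAddTorus.mFourier k t := by
  simp only [planeWave, ContinuousMap.coe_mk, UnitAddTorus.mFourier]
  congr 1
  rw [Complex.ofReal_sum, Finset.mul_sum, Complex.exp_sum]
  refine Finset.prod_congr rfl fun j _ => ?_
  conv_rhs => rw [← coe_circleSection_div hL (t j), fourier_coe_apply]
  congr 1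
  simp only [boxSection]
  push_cast
  ring

/-! ### The bases of plane waves -/

theorem coeFn_planeWaveLp (d : ℕ) (L : ℝ) (k : Fin d → ℤ) :
    planeWaveLp d L k =ᵐ[volume] planeWave d L k :=
  ContinuousMap.coeFn_toLp volume (planeWave d L k)

theorem coeFn_tprod {d N : ℕ} {L : ℝ} (φ : Fin N → H1 d L) :
    tprod φ =ᵐ[volume] fun x => ∏ i, φ i (x i) := (memLp_tprod φ).coeFn_toLp

theorem coeFn_tprod_congr {d N : ℕ} {L : ℝ} {φ : Fin N → H1 d L} {g : Fin N → Box d L → ℂ}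
    (h : ∀ i, φ i =ᵐ[volume] g i) : tprod φ =ᵐ[volume] fun x => ∏ i, g i (x i) := by
  refine (coeFn_tprod φ).trans ?_
  have h1 : ∀ i, ∀ᵐ x : Fin N → Box d L, φ i (x i) = g i (x i) := fun i =>
    (Measure.quasiMeasurePreserving_eval (fun _ : Fin N => (volume : Measure (Box d L))) i).ae
      (h i)
  filter_upwards [ae_all_iff.2 h1] with x hx
  exact Finset.prod_congr rfl fun i _ => hx i

theorem inner_tprod {d N : ℕ} {L : ℝ} (φ ψ : Fin N → H1 d L) :
    inner ℂ (tprod φ) (tprod ψ) = ∏ i, inner ℂ (φ i) (ψ i) := by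
  simp only [L2.inner_def]
  rw [← integral_fintype_prod_volume_eq_prod]
  refine integral_congr_ae ?_
  filter_upwards [coeFn_tprod φ, coeFn_tprod ψ] with x h1 h2
  simp only [h1, h2, RCLike.inner_apply, map_prod, Finset.prod_mul_distrib]

theorem norm_tprod {d N : ℕ} {L : ℝ} (φ : Fin N → H1 d L) : ‖tprod φ‖ = ∏ i, ‖φ i‖ := by
  have h := inner_tprod φ φ
  simp only [inner_self_eq_norm_sq_to_K, Finset.prod_pow] at h
  have h' : ‖tprod φ‖ ^ 2 = (∏ i, ‖φ i‖) ^ 2 := by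
    apply Complex.ofReal_injective
    push_cast
    simpa using h
  exact (pow_left_inj₀ (norm_nonneg _) (Finset.prod_nonneg fun i _ => norm_nonneg _)
    two_ne_zero).1 h'

theorem orthonormal_planeWaveLp (d : ℕ) {L : ℝ} (hL : 0 < L) :
    Orthonormal ℂ (planeWaveLp d L) := by
  classical
  rw [orthonormal_iff_ite]
  intro m n
  rw [planeWaveLp, planeWaveLp, ContinuousMap.inner_toLp]
  simp only [mul_comm (planeWave d L n _)]
  refine integral_conj_mul_of_section (measurePreserving_boxSection d hL)
    (pow_ne_zero _ (by simpa using hL)) ?_ (ENNReal.pow_ne_top ENNReal.ofReal_ne_top)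
    (fun n => (planeWave d L n).continuous.aestronglyMeasurable) (planeWave_boxSection d hL) m n
  -- The squared amplitude $L^{-d}$ of a plane wave equals the factor by which the section rescales
  -- Lebesgue measure.
  rw [ENNReal.toReal_pow, ENNReal.toReal_ofReal (inv_pos.2 hL).le, map_inv₀, Complex.conj_ofReal,
    ← mul_inv, ← Complex.ofReal_mul, Real.mul_self_sqrt (pow_pos hL d).le]
  push_cast
  rw [inv_pow]

/-- The Hilbert basis of plane waves. -/
def planeWaveBasis (d : ℕ) {L : ℝ} (hL : 0 < L) : HilbertBasis (Fin d → ℤ) ℂ (H1 d L) :=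
  HilbertBasis.mkOfOrthogonalEqBot (orthonormal_planeWaveLp d hL) (by
    rw [Submodule.eq_bot_iff]
    intro F hF
    rw [Lp.eq_zero_iff_ae_eq_zero]
    refine ae_eq_zero_of_section (measurePreserving_boxSection d hL)
      (pow_ne_zero _ (by simpa using hL)) (ENNReal.pow_ne_top ENNReal.ofReal_ne_top)
      (κ := ((Real.sqrt (L ^ d))⁻¹ : ℂ)) (by simpa using (Real.sqrt_pos.2 (pow_pos hL d)).ne')
      (fun n => (planeWave d L n).continuous.aestronglyMeasurable) (planeWave_boxSection d hL)
      (Lp.memLp F) fun n => ?_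
    have h := (Submodule.mem_orthogonal _ _).1 hF _ (Submodule.subset_span ⟨n, rfl⟩)
    rw [L2.inner_def] at h
    rw [← h]
    refine integral_congr_ae ?_
    filter_upwards [coeFn_planeWaveLp d L n] with x hx
    rw [hx, RCLike.inner_apply, mul_comm])

theorem coe_planeWaveBasis (d : ℕ) {L : ℝ} (hL : 0 < L) (k : Fin d → ℤ) :
    planeWaveBasis d hL k = planeWaveLp d L k :=
  congrFun (HilbertBasis.coe_mkOfOrthogonalEqBot _ _) k

/-- Products of plane waves. -/
def configWave (d : ℕ) {N : ℕ} (L : ℝ) (k : Fin N → Fin d → ℤ) : HN d N L :=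
  tprod fun i => planeWaveLp d L (k i)

theorem orthonormal_configWave (d N : ℕ) {L : ℝ} (hL : 0 < L) :
    Orthonormal ℂ (configWave d (N := N) L) := by
  classical
  rw [orthonormal_iff_ite]
  intro m n
  simp only [configWave, inner_tprod, orthonormal_iff_ite.1 (orthonormal_planeWaveLp d hL)]
  rw [Fintype.prod_ite_zero]
  simp [funext_iff]

/-- The Hilbert basis of products of plane waves. -/
def configBasis (d N : ℕ) {L : ℝ} (hL : 0 < L) : HilbertBasis (Fin N → Fin d → ℤ) ℂ (HN d N L) :=
  HilbertBasis.mkOfOrthogonalEqBot (orthonormal_configWave d N hL) (by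
    rw [Submodule.eq_bot_iff]
    intro F hF
    rw [Lp.eq_zero_iff_ae_eq_zero]
    -- Completeness is obtained from one torus of dimension `N * d`, on which products of plane
    -- waves become Fourier monomials.
    refine ae_eq_zero_of_section (measurePreserving_configSection d N hL)
      (pow_ne_zero _ (pow_ne_zero _ (by simpa using hL)))
      (ENNReal.pow_ne_top (ENNReal.pow_ne_top ENNReal.ofReal_ne_top))
      (κ := ((Real.sqrt (L ^ d))⁻¹ : ℂ) ^ N)
      (e := fun n x => ∏ i, planeWave d L (fun j => n (i, j)) (x i))
      (pow_ne_zero _ (by simpa using (Real.sqrt_pos.2 (pow_pos hL d)).ne'))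
      (fun n => (by fun_prop : Continuous fun x : Fin N → Box d L =>
        ∏ i, planeWave d L (fun j => n (i, j)) (x i)).aestronglyMeasurable) (fun n t => ?_)
      (Lp.memLp F) fun n => ?_
    · simp only [configSection, planeWave_boxSection, Finset.prod_mul_distrib, Finset.prod_const,
        Finset.card_univ, Fintype.card_fin, UnitAddTorus.mFourier, ContinuousMap.coe_mk,
        Fintype.prod_prod_type]
    · have h := (Submodule.mem_orthogonal _ _).1 hF _
        (Submodule.subset_span ⟨fun i j => n (i, j), rfl⟩)
      rw [L2.inner_def] at h
      rw [← h]
      refine integral_congr_ae ?_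
      filter_upwards [coeFn_tprod_congr fun i => coeFn_planeWaveLp d L fun j => n (i, j)]
        with x hx
      rw [configWave, hx, RCLike.inner_apply, mul_comm])

theorem coe_configBasis (d N : ℕ) {L : ℝ} (hL : 0 < L) (k : Fin N → Fin d → ℤ) :
    configBasis d N hL k = configWave d L k :=
  congrFun (HilbertBasis.coe_mkOfOrthogonalEqBot _ _) k

/-! ### Products of absolutely convergent series -/

/-- This is what factors sums over `N`-tuples of momenta; induction splits off the first index. -/
theorem summable_norm_and_hasSum_prod {J : Type} (n : ℕ) (f : Fin n → J → ℂ)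
    (hf : ∀ i, Summable fun j => ‖f i j‖) :
    (Summable fun k : Fin n → J => ‖∏ i, f i (k i)‖) ∧
      HasSum (fun k : Fin n → J => ∏ i, f i (k i)) (∏ i, ∑' j, f i j) := by
  induction n with
  | zero =>
    refine ⟨(hasSum_fintype _).summable, ?_⟩
    simp
  | succ n ih =>
    obtain ⟨h1, h2⟩ := ih (fun i => f i.succ) fun i => hf i.succ
    let e := Fin.consEquiv fun _ : Fin (n + 1) => J
    have he : ∀ q : J × (Fin n → J), ∏ i, f i (e q i) = f 0 q.1 * ∏ i, f (Fin.succ i) (q.2 i) := by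
      intro q
      rw [Fin.prod_univ_succ]
      simp [e]
    constructor
    · rw [← e.summable_iff]
      refine ((hf 0).mul_of_nonneg h1 (fun _ => norm_nonneg _) fun _ => norm_nonneg _).congr
        fun q => ?_
      rw [Function.comp_apply, he, norm_mul]
    · rw [← e.hasSum_iff]
      have h3 : Summable fun q : J × (Fin n → J) => f 0 q.1 * ∏ i, f (Fin.succ i) (q.2 i) :=
        summable_mul_of_summable_norm (f := f 0)
          (g := fun k : Fin n → J => ∏ i, f (Fin.succ i) (k i)) (hf 0) h1
      rw [Fin.prod_univ_succ]
      exact ((hf 0).of_norm.hasSum.mul h2 h3).congr_fun fun q => he q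

theorem summable_prod_of_nonneg {J : Type} (n : ℕ) (f : Fin n → J → ℝ) (h0 : ∀ i j, 0 ≤ f i j)
    (hf : ∀ i, Summable (f i)) : Summable fun k : Fin n → J => ∏ i, f i (k i) := by
  refine (summable_norm_and_hasSum_prod n (fun i j => (f i j : ℂ)) fun i => ?_).1.congr fun k => ?_
  · simpa [abs_of_nonneg (h0 i _)] using hf i
  · rw [norm_prod]
    exact Finset.prod_congr rfl fun i _ => by simp [abs_of_nonneg (h0 i _)]

/-! ### The trace -/

section Trace

variable {H : Type} [NormedAddCommGroup H] [InnerProductSpace ℂ H]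

/-- Cauchy–Schwarz followed by Bessel's inequality. -/
theorem sum_norm_inner_mul_norm_inner_le {ι : Type} {v : ι → H} (hv : Orthonormal ℂ v) (x y : H)
    (s : Finset ι) : ∑ i ∈ s, ‖inner ℂ (v i) x‖ * ‖inner ℂ y (v i)‖ ≤ ‖x‖ * ‖y‖ := by
  simp only [norm_inner_symm y]
  refine (Real.sum_mul_le_sqrt_mul_sqrt s _ _).trans ?_
  refine mul_le_mul ?_ ?_ (Real.sqrt_nonneg _) (norm_nonneg _)
  · exact Real.sqrt_le_iff.2 ⟨norm_nonneg _, hv.sum_inner_products_le x⟩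
  · exact Real.sqrt_le_iff.2 ⟨norm_nonneg _, hv.sum_inner_products_le y⟩

/-- A nuclear operator has a trace. -/
theorem hasOpTrace_of_hasSum_rankOne {J : Type} {A : H →L[ℂ] H} {u v : J → H}
    (hs : Summable fun j => ‖u j‖ * ‖v j‖)
    (hA : HasSum (fun j => InnerProductSpace.rankOne ℂ (u j) (v j)) A) :
    HasOpTrace A (∑' j, inner ℂ (v j) (u j)) := by
  intro ι b
  -- This double series converges absolutely. Summed first over the basis it gives `inner ℂ (v j) (u
  -- j)` by Parseval; summed first over `j`, the diagonal elements of `A`.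
  let F : J × ι → ℂ := fun q => inner ℂ (v q.1) (b q.2) * inner ℂ (b q.2) (u q.1)
  have hbd : ∀ j (s : Finset ι), ∑ i ∈ s, ‖F (j, i)‖ ≤ ‖u j‖ * ‖v j‖ := fun j s => by
    simpa only [F, norm_mul, mul_comm ‖inner ℂ (v j) _‖] using
      sum_norm_inner_mul_norm_inner_le b.orthonormal (u j) (v j) s
  have h1 : ∀ j, Summable fun i => ‖F (j, i)‖ := fun j =>
    summable_of_sum_le (fun _ => norm_nonneg _) (hbd j)
  have hF : Summable F := by
    refine Summable.of_norm ((_root_.summable_prod_of_nonneg fun q => norm_nonneg (F q)).2 ⟨h1, ?_⟩)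
    exact hs.of_nonneg_of_le (fun j => tsum_nonneg fun i => norm_nonneg _)
      fun j => (h1 j).tsum_le_of_sum_le (hbd j)
  have h2 : HasSum (fun j => inner ℂ (v j) (u j)) (∑' q, F q) :=
    hF.hasSum.prod_fiberwise fun j => b.hasSum_inner_mul_inner (v j) (u j)
  rw [h2.tsum_eq]
  have h3 : HasSum (fun q : ι × J => F q.swap) (∑' q, F q) :=
    (Equiv.prodComm ι J).hasSum_iff.2 hF.hasSum
  refine h3.prod_fiberwise fun i => ?_
  have h4 := (hA.mapL (ContinuousLinearMap.apply ℂ H (b i))).mapL (innerSL ℂ (b i))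
  refine h4.congr_fun fun j => ?_
  simp [F]

theorem HasOpTrace.unique [CompleteSpace H] {A : H →L[ℂ] H} {s t : ℂ} (hs : HasOpTrace A s)
    (ht : HasOpTrace A t) : s = t := by
  obtain ⟨w, b, -⟩ := exists_hilbertBasis ℂ H
  exact (hs _ b).unique (ht _ b)

theorem HasOpTrace.opTrace_eq [CompleteSpace H] {A : H →L[ℂ] H} {t : ℂ} (h : HasOpTrace A t) :
    opTrace A = t := by
  have hA : IsTraceClass A := ⟨t, h⟩
  rw [opTrace, dif_pos hA]
  exact hA.choose_spec.unique h

theorem HasOpTrace.smul {A : H →L[ℂ] H} {t : ℂ} (h : HasOpTrace A t) (c : ℂ) :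
    HasOpTrace (c • A) (c * t) := fun ι b =>
  ((h ι b).mul_left c).congr_fun fun i => by simp

theorem HasOpTrace.sum {J : Type} {s : Finset J} {A : J → H →L[ℂ] H} {t : J → ℂ}
    (h : ∀ j, HasOpTrace (A j) (t j)) : HasOpTrace (∑ j ∈ s, A j) (∑ j ∈ s, t j) := fun ι b =>
  (hasSum_sum fun j _ => h j ι b).congr_fun fun i => by simp

end Trace

/-! ### Tensor powers of operators and their traces -/

section TensorPower

variable {d N : ℕ} {L : ℝ}

theorem permOp_tprod (σ : Sym N) (φ : Fin N → H1 d L) :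
    permOp d L σ (tprod φ) = tprod fun j => φ (σ⁻¹ j) := by
  apply Lp.ext
  have h1 := Lp.coeFn_compMeasurePreserving (tprod φ) (measurePreserving_perm (d := d) (L := L) σ)
  have h2 := (measurePreserving_perm (d := d) (L := L) σ).quasiMeasurePreserving.ae
    (coeFn_tprod φ)
  refine Filter.EventuallyEq.trans h1 ?_
  filter_upwards [h2, coeFn_tprod fun j => φ (σ⁻¹ j)] with x hx hx'
  rw [hx', Function.comp_apply, hx, ← Equiv.prod_comp σ fun j => φ (σ⁻¹ j) (x j)]
  simp

/-- Bounded operators on the `N`-particle space are determined by their values on products. -/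
theorem ext_tprod (hL : 0 < L) {B C : HN d N L →L[ℂ] HN d N L}
    (h : ∀ φ : Fin N → H1 d L, B (tprod φ) = C (tprod φ)) : B = C := by
  refine ContinuousLinearMap.ext_on (s := Set.range (configBasis d N hL)) ?_ ?_
  · rw [Submodule.dense_iff_topologicalClosure_eq_top]
    exact (configBasis d N hL).dense_span
  · rintro _ ⟨k, rfl⟩
    rw [coe_configBasis]
    exact h _

theorem hasSum_inner_planeWaveLp (hL : 0 < L) (A : H1 d L →L[ℂ] H1 d L) (φ : H1 d L) :
    HasSum (fun k => inner ℂ (planeWaveLp d L k) φ • A (planeWaveLp d L k)) (A φ) := by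
  refine ((planeWaveBasis d hL).hasSum_repr φ |>.mapL A).congr_fun fun k => ?_
  rw [HilbertBasis.repr_apply_apply, coe_planeWaveBasis, map_smul]

theorem summable_norm_tprod_map {A : H1 d L →L[ℂ] H1 d L}
    (hA : Summable fun k => ‖A (planeWaveLp d L k)‖) :
    Summable fun k : Fin N → Fin d → ℤ => ‖tprod fun i => A (planeWaveLp d L (k i))‖ := by
  simp only [norm_tprod]
  exact summable_prod_of_nonneg N (fun _ k => ‖A (planeWaveLp d L k)‖) (fun _ _ => norm_nonneg _)
    fun _ => hA

theorem hasSum_rankOne_configWave (hL : 0 < L) {A : H1 d L →L[ℂ] H1 d L}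
    (hA : Summable fun k => ‖A (planeWaveLp d L k)‖) :
    HasSum (fun k : Fin N → Fin d → ℤ => InnerProductSpace.rankOne ℂ
      (tprod fun i => A (planeWaveLp d L (k i))) (configWave d L k))
      (∑' k : Fin N → Fin d → ℤ, InnerProductSpace.rankOne ℂ
        (tprod fun i => A (planeWaveLp d L (k i))) (configWave d L k)) := by
  refine (Summable.of_norm ?_).hasSum
  refine (summable_norm_tprod_map (N := N) hA).congr fun k => ?_
  rw [InnerProductSpace.norm_rankOne, (orthonormal_configWave d N hL).1, mul_one]

/-- Both sides have the same coefficients in the product basis: each is a product over particles of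
$\langle e_{l_i},A\varphi_i\rangle=\sum_k\langle e_k,\varphi_i\rangle\langle e_{l_i},Ae_k\rangle$,
multiplied out by absolute convergence. -/
theorem isTensorPower_tsum (hL : 0 < L) {A : H1 d L →L[ℂ] H1 d L}
    (hA : Summable fun k => ‖A (planeWaveLp d L k)‖) :
    IsTensorPower A (∑' k : Fin N → Fin d → ℤ, InnerProductSpace.rankOne ℂ
      (tprod fun i => A (planeWaveLp d L (k i))) (configWave d L k)) := by
  intro φ
  apply (configBasis d N hL).repr.injective
  ext l
  simp only [HilbertBasis.repr_apply_apply, coe_configBasis]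
  have h1 := ((hasSum_rankOne_configWave (N := N) hL hA).mapL
    (ContinuousLinearMap.apply ℂ _ (tprod φ))).mapL (innerSL ℂ (configWave d L l))
  refine h1.unique ?_
  let f : Fin N → (Fin d → ℤ) → ℂ := fun i k =>
    inner ℂ (planeWaveLp d L k) (φ i) * inner ℂ (planeWaveLp d L (l i)) (A (planeWaveLp d L k))
  have hon := orthonormal_planeWaveLp d hL
  have hf : ∀ i, Summable fun k => ‖f i k‖ := fun i => by
    refine (hA.mul_left ‖φ i‖).of_nonneg_of_le (fun _ => norm_nonneg _) fun k => ?_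
    rw [norm_mul]
    refine mul_le_mul ?_ ?_ (norm_nonneg _) (norm_nonneg _)
    · simpa [hon.1] using norm_inner_le_norm (𝕜 := ℂ) (planeWaveLp d L k) (φ i)
    · simpa [hon.1] using norm_inner_le_norm (𝕜 := ℂ) (planeWaveLp d L (l i))
        (A (planeWaveLp d L k))
  have h2 := (summable_norm_and_hasSum_prod N f hf).2
  have h3 : ∀ i, ∑' k, f i k = inner ℂ (planeWaveLp d L (l i)) (A (φ i)) := fun i => by
    refine HasSum.tsum_eq ?_
    refine ((hasSum_inner_planeWaveLp hL A (φ i)).mapL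
      (innerSL ℂ (planeWaveLp d L (l i)))).congr_fun fun k => ?_
    simp [f]
  simp only [h3] at h2
  rw [configWave, inner_tprod]
  refine h2.congr_fun fun k => ?_
  simp [f, configWave, inner_tprod, Finset.prod_mul_distrib]

theorem existsUnique_isTensorPower (hL : 0 < L) {A : H1 d L →L[ℂ] H1 d L}
    (hA : Summable fun k => ‖A (planeWaveLp d L k)‖) :
    ∃! B : HN d N L →L[ℂ] HN d N L, IsTensorPower A B :=
  ⟨_, isTensorPower_tsum hL hA, fun _ hC =>
    ext_tprod hL fun φ => (hC φ).trans (isTensorPower_tsum hL hA φ).symm⟩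

theorem tensorPower_eq (hL : 0 < L) {A : H1 d L →L[ℂ] H1 d L}
    (hA : Summable fun k => ‖A (planeWaveLp d L k)‖) :
    tensorPower N A = ∑' k : Fin N → Fin d → ℤ, InnerProductSpace.rankOne ℂ
      (tprod fun i => A (planeWaveLp d L (k i))) (configWave d L k) := by
  have h : ∃ B : HN d N L →L[ℂ] HN d N L, IsTensorPower A B := ⟨_, isTensorPower_tsum hL hA⟩
  rw [tensorPower, dif_pos h]
  exact (existsUnique_isTensorPower hL hA).unique h.choose_spec (isTensorPower_tsum hL hA)

/-- The trace of `(⊗^N A) U(σ)` in terms of the matrix elements of `A`. -/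
def traceForm (A : H1 d L →L[ℂ] H1 d L) (σ : Sym N) : ℂ :=
  ∑' k : Fin N → Fin d → ℤ, ∏ j,
    inner ℂ (planeWaveLp d L (k j)) (A (planeWaveLp d L (k (σ⁻¹ j))))

/-- Composing the rank-one expansion of the tensor power with $U(\sigma)$ puts its adjoint on the
second vectors, and the series stays nuclear. -/
theorem hasOpTrace_tensorPower_mul_permOp (hL : 0 < L) {A : H1 d L →L[ℂ] H1 d L}
    (hA : Summable fun k => ‖A (planeWaveLp d L k)‖) (σ : Sym N) :
    HasOpTrace (tensorPower N A * permOp d L σ) (traceForm A σ) := by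
  have hs := (hasSum_rankOne_configWave (N := N) hL hA).mul_right (permOp d L σ)
  rw [← tensorPower_eq hL hA] at hs
  simp only [ContinuousLinearMap.mul_def, InnerProductSpace.rankOne_comp] at hs
  have ht : traceForm A σ = ∑' k, inner ℂ
      (ContinuousLinearMap.adjoint (permOp d L σ) (configWave d L k))
      (tprod fun i => A (planeWaveLp d L (k i))) :=
    tsum_congr fun k => by
      rw [ContinuousLinearMap.adjoint_inner_left, permOp_tprod, configWave, inner_tprod]
  rw [ht]
  refine hasOpTrace_of_hasSum_rankOne ?_ hs
  · refine ((summable_norm_tprod_map (N := N) hA).mul_right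
      ‖ContinuousLinearMap.adjoint (permOp d L σ)‖).of_nonneg_of_le (fun k => by positivity)
      fun k => ?_
    refine mul_le_mul_of_nonneg_left ?_ (norm_nonneg _)
    simpa [(orthonormal_configWave d N hL).1] using
      (ContinuousLinearMap.adjoint (permOp d L σ)).le_opNorm (configWave d L k)

/-- Relabel the momenta by `τ`, then the factors of each product. -/
theorem traceForm_conj (A : H1 d L →L[ℂ] H1 d L) (σ τ : Sym N) :
    traceForm A (τ * σ * τ⁻¹) = traceForm A σ := by
  rw [traceForm, traceForm, ← (Equiv.arrowCongr τ (Equiv.refl (Fin d → ℤ))).tsum_eq]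
  refine tsum_congr fun k => ?_
  rw [← Equiv.prod_comp τ]
  refine Finset.prod_congr rfl fun j _ => ?_
  simp [Equiv.arrowCongr, mul_assoc]

theorem hasOpTrace_tensorPower_mul_algOp (hL : 0 < L) {A : H1 d L →L[ℂ] H1 d L}
    (hA : Summable fun k => ‖A (planeWaveLp d L k)‖) (g : GrpAlg N) :
    HasOpTrace (tensorPower N A * algOp d L g) (evalAt (traceForm A) g) := by
  rw [algOp, Finset.mul_sum, evalAt_apply]
  refine HasOpTrace.sum fun σ => ?_
  rw [mul_smul_comm]
  exact (hasOpTrace_tensorPower_mul_permOp hL hA σ).smul _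

end TensorPower

/-! ### Positivity -/

open scoped ComplexOrder in
/-- The trace form of an operator that is diagonal with positive eigenvalues in the basis of plane
waves is a positive definite function on the symmetric group. -/
theorem sum_mul_traceForm_pos {d N : ℕ} (hd : 0 < d) {L : ℝ} (hL : 0 < L)
    {A : H1 d L →L[ℂ] H1 d L} {w : (Fin d → ℤ) → ℝ} (hw : ∀ k, 0 < w k) (hws : Summable w)
    (hA : ∀ k, A (planeWaveLp d L k) = (w k : ℂ) • planeWaveLp d L k)
    {Q : Type} [Fintype Q] [Nonempty Q] {g : Q → Sym N} (hg : Function.Injective g) {s : Q → ℂ}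
    (hs : ∀ q, s q ≠ 0) :
    0 < ∑ q', ∑ q, s q * (starRingEnd ℂ) (s q') * traceForm A (g q * (g q')⁻¹) := by
  classical
  have honN := orthonormal_configWave d N hL
  let V : (Fin N → Fin d → ℤ) → HN d N L := fun k =>
    ∑ q, (starRingEnd ℂ) (s q) • configWave d L (k ∘ g q)
  -- `A` is diagonal, and the product of its eigenvalues does not see the permutation; only an inner
  -- product of permuted waves remains. The double sum thus becomes $\sum_k\prod_j
  -- w(k_j)\,\|V_k\|^2$.
  have hterm : ∀ (k : Fin N → Fin d → ℤ) (q q' : Q), ∏ j, inner ℂ (planeWaveLp d L (k j))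
      (A (planeWaveLp d L (k ((g q * (g q')⁻¹)⁻¹ j)))) =
      ((∏ j, w (k j) : ℝ) : ℂ) *
        inner ℂ (configWave d L (k ∘ g q)) (configWave d L (k ∘ g q')) := by
    intro k q q'
    simp only [hA, inner_smul_right, Finset.prod_mul_distrib]
    rw [Equiv.prod_comp (g q * (g q')⁻¹)⁻¹ fun j => (w (k j) : ℂ), ← Complex.ofReal_prod,
      configWave, configWave, inner_tprod,
      ← Equiv.prod_comp (g q) fun j => inner ℂ (planeWaveLp d L (k j))
        (planeWaveLp d L (k ((g q * (g q')⁻¹)⁻¹ j)))]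
    simp
  have hsum : ∀ q q' : Q, HasSum (fun k : Fin N → Fin d → ℤ => ((∏ j, w (k j) : ℝ) : ℂ) *
      inner ℂ (configWave d L (k ∘ g q)) (configWave d L (k ∘ g q')))
      (traceForm A (g q * (g q')⁻¹)) := by
    intro q q'
    simp only [traceForm, hterm]
    refine Summable.hasSum (Summable.of_norm_bounded
      (summable_prod_of_nonneg N (fun _ => w) (fun _ k => (hw k).le) fun _ => hws) fun k => ?_)
    have h1 : 0 ≤ ∏ j, w (k j) := Finset.prod_nonneg fun j _ => (hw _).le
    rw [norm_mul, Complex.norm_real, Real.norm_of_nonneg h1]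
    refine mul_le_of_le_one_right h1 ?_
    simpa [honN.1] using norm_inner_le_norm (𝕜 := ℂ) (configWave d L (k ∘ g q))
      (configWave d L (k ∘ g q'))
  have htot : HasSum (fun k : Fin N → Fin d → ℤ => (((∏ j, w (k j)) * ‖V k‖ ^ 2 : ℝ) : ℂ))
      (∑ q', ∑ q, s q * (starRingEnd ℂ) (s q') * traceForm A (g q * (g q')⁻¹)) := by
    refine (hasSum_sum fun q' _ => hasSum_sum fun q _ => (hsum q q').mul_left _).congr_fun
      fun k => ?_
    have hV : ((‖V k‖ ^ 2 : ℝ) : ℂ) = inner ℂ (V k) (V k) := by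
      rw [inner_self_eq_norm_sq_to_K]; simp
    rw [Complex.ofReal_mul, hV]
    simp only [V, sum_inner, inner_sum, inner_smul_left, inner_smul_right, Complex.conj_conj,
      Finset.mul_sum]
    exact Finset.sum_congr rfl fun q' _ => Finset.sum_congr rfl fun q _ => by ring
  set t := ∑ q', ∑ q, s q * (starRingEnd ℂ) (s q') * traceForm A (g q * (g q')⁻¹)
  have hre : HasSum (fun k : Fin N → Fin d → ℤ => (∏ j, w (k j)) * ‖V k‖ ^ 2) t.re := by
    exact (htot.mapL Complex.reCLM).congr_fun fun k => (Complex.ofReal_re _).symm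
  have ht : t = (t.re : ℂ) := htot.unique (by simpa using hre.mapL Complex.ofRealCLM)
  have hnn : ∀ k : Fin N → Fin d → ℤ, 0 ≤ (∏ j, w (k j)) * ‖V k‖ ^ 2 := fun k =>
    mul_nonneg (Finset.prod_nonneg fun j _ => (hw _).le) (sq_nonneg _)
  have : Nonempty (Fin d) := ⟨⟨0, hd⟩⟩
  -- With distinct momenta the waves `k₀ ∘ g q` are pairwise orthogonal, so nonzero coefficients
  -- give `V k₀ ≠ 0`. Here `0 < d` matters: it provides infinitely many momenta.
  let k₀ : Fin N → Fin d → ℤ := fun i => Infinite.natEmbedding (Fin d → ℤ) i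
  have hk₀ : Function.Injective k₀ := (Infinite.natEmbedding (Fin d → ℤ)).injective.comp
    Fin.val_injective
  have hcomp : ∀ q q', k₀ ∘ g q = k₀ ∘ g q' ↔ q = q' := fun q q' =>
    ⟨fun h => hg (Equiv.ext fun i => hk₀ (congrFun h i)), fun h => by rw [h]⟩
  have hV0 : V k₀ ≠ 0 := by
    intro h
    obtain ⟨q⟩ := ‹Nonempty Q›
    have h1 : inner ℂ (configWave d L (k₀ ∘ g q)) (V k₀) = (starRingEnd ℂ) (s q) := by
      simp only [V, inner_sum, inner_smul_right, orthonormal_iff_ite.1 honN, hcomp]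
      simp
    rw [h, inner_zero_right] at h1
    exact hs q (by simpa using h1.symm)
  have hpos : 0 < t.re := by
    rw [← hre.tsum_eq]
    refine hre.summable.tsum_pos hnn k₀ ?_
    exact mul_pos (Finset.prod_pos fun j _ => hw _) (pow_pos (norm_pos_iff.2 hV0) 2)
  rw [ht]
  exact_mod_cast hpos

-- The strict positivity of the quadratic form, taken with coefficients `sgn c` at the distinct
-- permutations `r * c`, passes to the Young symmetrizer and then to $d(T)$ through the factor
-- $d_T/N!>0$.
open scoped ComplexOrder in
theorem evalAt_traceForm_dElt_pos {d N : ℕ} (hd : 0 < d) {L : ℝ} (hL : 0 < L)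
    {A : H1 d L →L[ℂ] H1 d L} {w : (Fin d → ℤ) → ℝ} (hw : ∀ k, 0 < w k) (hws : Summable w)
    (hA : ∀ k, A (planeWaveLp d L k) = (w k : ℂ) • planeWaveLp d L k)
    {μ : YoungDiagram} (T : Tableau N μ) : 0 < evalAt (traceForm A) (dElt T) := by
  classical
  have hφ : ∀ σ τ : Sym N, traceForm A (τ * σ * τ⁻¹) = traceForm A σ := traceForm_conj A
  obtain ⟨κ, hκ⟩ := exists_youngSym_mul_self T
  have hdim : 0 < (irrepDim T : ℂ) := by
    have h := mul_irrepDim T hκ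
    refine Nat.cast_pos.2 (Nat.pos_of_ne_zero fun h0 => ?_)
    rw [h0, Nat.cast_zero, mul_zero] at h
    exact Nat.cast_ne_zero.2 N.factorial_ne_zero h.symm
  have hN : 0 < (N.factorial : ℂ) := Nat.cast_pos.2 N.factorial_pos
  have hq := sum_mul_traceForm_pos hd hL hw hws hA (rowStab_mul_colStab_injective T)
    (s := fun q => sgn (q.2 : Sym N)) fun q h => by
      have := sgn_mul_self (q.2 : Sym N)
      rw [h] at this
      simp at this
  simp only [star_sgn] at hq
  rw [← card_mul_evalAt_youngSym T hφ] at hq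
  rw [evalAt_dElt_eq T hφ]
  refine mul_pos (div_pos hdim hN) (pos_of_mul_pos_right hq ?_)
  exact Nat.cast_nonneg _

/-! ### Integral kernels -/

/-- A convex set with nonempty interior lies in the closure of that interior, so a relatively open
set also meets the interior. Needed to pass from almost everywhere equality of continuous functions
to equality. -/
theorem isOpenPosMeasure_box (d : ℕ) {L : ℝ} (hL : 0 < L) :
    (volume : Measure (Box d L)).IsOpenPosMeasure := by
  refine ⟨fun U hU hne h0 => ?_⟩
  let I : Set (Fin d → ℝ) := Set.Icc (fun _ => -(L / 2)) (fun _ => L / 2)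
  obtain ⟨V, hV, rfl⟩ := isOpen_induced_iff.1 hU
  obtain ⟨x, hx⟩ := hne
  have hint : (interior I).Nonempty := by
    refine ⟨fun _ => 0, ?_⟩
    simp only [I, ← Set.pi_univ_Icc]
    rw [interior_pi_set Set.finite_univ]
    intro j _
    rw [interior_Icc]
    constructor <;> linarith
  have hcl : (x : Fin d → ℝ) ∈ closure (interior I) := by
    rw [(convex_Icc (𝕜 := ℝ) _ _).closure_interior_eq_closure_of_nonempty_interior hint]
    exact subset_closure x.2
  obtain ⟨y, hyV, hyI⟩ := mem_closure_iff.1 hcl V hV hx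
  have hpos : 0 < volume (V ∩ interior I) := (hV.inter isOpen_interior).measure_pos _ ⟨y, hyV, hyI⟩
  refine hpos.ne' (measure_mono_null ?_
    ((comap_subtype_coe_apply measurableSet_Icc volume _).symm.trans h0))
  rintro z ⟨hzV, hzI⟩
  exact ⟨⟨z, interior_subset hzI⟩, hzV, rfl⟩

section Kernel

variable {d : ℕ} {L : ℝ}

theorem norm_planeWave_apply (k : Fin d → ℤ) (x : Box d L) :
    ‖planeWave d L k x‖ = (Real.sqrt (L ^ d))⁻¹ := by
  simp only [planeWave, ContinuousMap.coe_mk, norm_mul, norm_inv, Complex.norm_real]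
  rw [mul_comm Complex.I, Complex.norm_exp_ofReal_mul_I, mul_one,
    Real.norm_of_nonneg (Real.sqrt_nonneg _)]

theorem inner_planeWaveLp (k : Fin d → ℤ) (φ : H1 d L) :
    inner ℂ (planeWaveLp d L k) φ = ∫ y, (starRingEnd ℂ) (planeWave d L k y) * φ y := by
  rw [L2.inner_def]
  refine integral_congr_ae ?_
  filter_upwards [coeFn_planeWaveLp d L k] with x hx
  rw [hx, RCLike.inner_apply, mul_comm]

/-- The operator `A` maps the plane waves to continuous functions `a k` with summable sup norms. -/
structure IsSmoothing (A : H1 d L →L[ℂ] H1 d L) (a : (Fin d → ℤ) → C(Box d L, ℂ)) : Prop where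
  map_planeWaveLp : ∀ k, A (planeWaveLp d L k) = ContinuousMap.toLp (E := ℂ) 2 volume ℂ (a k)
  summable : Summable fun k => ‖a k‖

variable {A : H1 d L →L[ℂ] H1 d L} {a : (Fin d → ℤ) → C(Box d L, ℂ)}

theorem IsSmoothing.summable_norm (h : IsSmoothing A a) :
    Summable fun k => ‖A (planeWaveLp d L k)‖ := by
  refine (h.summable.mul_left
    ‖ContinuousMap.toLp (E := ℂ) 2 (volume : Measure (Box d L)) ℂ‖).of_nonneg_of_le
    (fun _ => norm_nonneg _) fun k => ?_
  rw [h.map_planeWaveLp]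
  exact ContinuousLinearMap.le_opNorm _ _

/-- The terms of the expansion of the integral kernel. -/
def kernelTerm (a : (Fin d → ℤ) → C(Box d L, ℂ)) (k : Fin d → ℤ) : C(Box d L × Box d L, ℂ) where
  toFun q := a k q.1 * (starRingEnd ℂ) (planeWave d L k q.2)
  continuous_toFun := by fun_prop

theorem norm_kernelTerm_apply_le (a : (Fin d → ℤ) → C(Box d L, ℂ)) (k : Fin d → ℤ)
    (q : Box d L × Box d L) : ‖kernelTerm a k q‖ ≤ ‖a k‖ * (Real.sqrt (L ^ d))⁻¹ := by
  simp only [kernelTerm, ContinuousMap.coe_mk, norm_mul, RCLike.norm_conj, norm_planeWave_apply]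
  exact mul_le_mul_of_nonneg_right ((a k).norm_coe_le_norm _) (by positivity)

/-- The integral kernel. -/
def kernelSum (a : (Fin d → ℤ) → C(Box d L, ℂ)) : C(Box d L × Box d L, ℂ) :=
  ∑' k, kernelTerm a k

theorem hasSum_kernelTerm (ha : Summable fun k => ‖a k‖) (q : Box d L × Box d L) :
    HasSum (fun k => kernelTerm a k q) (kernelSum a q) := by
  have h : Summable (kernelTerm a) := by
    refine Summable.of_norm ((ha.mul_right (Real.sqrt (L ^ d))⁻¹).of_nonneg_of_le
      (fun _ => norm_nonneg _) fun k => ?_)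
    exact (ContinuousMap.norm_le _ (by positivity)).2 (norm_kernelTerm_apply_le a k)
  exact h.hasSum.mapL (ContinuousMap.evalCLM ℂ q)

/-- Both sides equal $\sum_k\langle e_k,\varphi\rangle a_k(x)$: the left by expanding $\varphi$ in
plane waves, the right by termwise integration. -/
theorem IsSmoothing.isKernel (hL : 0 < L) (h : IsSmoothing A a) : IsKernel A (kernelSum a) := by
  intro φ
  have hφ : Integrable φ volume := (Lp.memLp φ).integrable (by norm_num)
  have hon := orthonormal_planeWaveLp d hL
  have hs : Summable fun k => inner ℂ (planeWaveLp d L k) φ • a k := by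
    refine Summable.of_norm ((h.summable.mul_left ‖φ‖).of_nonneg_of_le (fun _ => norm_nonneg _)
      fun k => ?_)
    rw [norm_smul]
    refine mul_le_mul_of_nonneg_right ?_ (norm_nonneg _)
    simpa [hon.1] using norm_inner_le_norm (𝕜 := ℂ) (planeWaveLp d L k) φ
  have h1 : A φ = ContinuousMap.toLp (E := ℂ) 2 volume ℂ
      (∑' k, inner ℂ (planeWaveLp d L k) φ • a k) := by
    refine (hasSum_inner_planeWaveLp hL A φ).unique ?_
    refine (hs.hasSum.mapL (ContinuousMap.toLp (E := ℂ) 2 volume ℂ)).congr_fun fun k => ?_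
    rw [map_smul, h.map_planeWaveLp]
  rw [h1]
  refine (ContinuousMap.coeFn_toLp volume _).trans (Filter.Eventually.of_forall fun x => ?_)
  refine (hs.hasSum.mapL (ContinuousMap.evalCLM ℂ x)).unique ?_
  have h2 := hasSum_integral_of_summable_integral_norm (μ := (volume : Measure (Box d L)))
    (F := fun k y => kernelTerm a k (x, y) * φ y) (fun k => ?_) ?_
  · have h3 : ∀ y, ∑' k, kernelTerm a k (x, y) * φ y = kernelSum a (x, y) * φ y := fun y =>
      ((hasSum_kernelTerm h.summable (x, y)).mul_right _).tsum_eq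
    simp only [h3] at h2
    refine h2.congr_fun fun k => ?_
    change inner ℂ (planeWaveLp d L k) φ • a k x = _
    rw [inner_planeWaveLp, smul_eq_mul, mul_comm, ← integral_const_mul]
    simp only [kernelTerm, ContinuousMap.coe_mk, mul_assoc]
  · refine hφ.bdd_mul (c := ‖a k‖ * (Real.sqrt (L ^ d))⁻¹) ?_
      (Filter.Eventually.of_forall fun y => norm_kernelTerm_apply_le a k (x, y))
    exact (by fun_prop : Continuous fun y => kernelTerm a k (x, y)).aestronglyMeasurable
  · refine ((h.summable.mul_right (Real.sqrt (L ^ d))⁻¹).mul_right (∫ y, ‖φ y‖)).of_nonneg_of_le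
      (fun k => integral_nonneg fun y => norm_nonneg _) fun k => ?_
    rw [← integral_const_mul]
    refine integral_mono_of_nonneg (Filter.Eventually.of_forall fun y => norm_nonneg _)
      (hφ.norm.const_mul _) (Filter.Eventually.of_forall fun y => ?_)
    dsimp only
    rw [norm_mul]
    exact mul_le_mul_of_nonneg_right (norm_kernelTerm_apply_le a k (x, y)) (norm_nonneg _)

/-- Testing on the countably many plane waves leaves a single null set of `x`. Off it, completeness
and continuity give equality for all `y`; continuity in `x` does the rest. -/
theorem IsKernel.unique (hL : 0 < L) {K K' : C(Box d L × Box d L, ℂ)} (hK : IsKernel A K)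
    (hK' : IsKernel A K') : K = K' := by
  have := isOpenPosMeasure_box d hL
  have h1 : ∀ᵐ x : Box d L, ∀ k : Fin d → ℤ,
      ∫ y, K (x, y) * planeWaveLp d L k y = ∫ y, K' (x, y) * planeWaveLp d L k y := by
    rw [ae_all_iff]
    intro k
    exact (hK (planeWaveLp d L k)).symm.trans (hK' (planeWaveLp d L k))
  have h2 : ∀ᵐ x : Box d L, ∀ y, K (x, y) = K' (x, y) := by
    filter_upwards [h1] with x hx
    let D : C(Box d L, ℂ) :=
      ⟨fun y => (starRingEnd ℂ) (K (x, y) - K' (x, y)), by fun_prop⟩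
    have hD : ContinuousMap.toLp (E := ℂ) 2 (volume : Measure (Box d L)) ℂ D = 0 := by
      apply (planeWaveBasis d hL).repr.injective
      rw [map_zero]
      ext k
      rw [HilbertBasis.repr_apply_apply, coe_planeWaveBasis, planeWaveLp,
        ContinuousMap.inner_toLp]
      have hi : ∀ K : C(Box d L × Box d L, ℂ),
          Integrable (fun y => K (x, y) * planeWaveLp d L k y) volume := fun K => by
        refine ((by fun_prop : Continuous fun y => K (x, y) * planeWave d L k y)
          |>.integrable_of_hasCompactSupport (HasCompactSupport.of_compactSpace _)).congr ?_
        filter_upwards [coeFn_planeWaveLp d L k] with y hy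
        rw [hy]
      have h3 := sub_eq_zero.2 (hx k)
      rw [← integral_sub (hi K) (hi K')] at h3
      have h4 := congrArg (starRingEnd ℂ) h3
      rw [← integral_conj, map_zero] at h4
      refine Eq.trans (integral_congr_ae ?_) h4
      filter_upwards [coeFn_planeWaveLp d L k] with y hy
      simp only [hy, D, ContinuousMap.coe_mk, ← sub_mul, map_mul]
    have hD0 : D = 0 := ContinuousMap.toLp_injective (E := ℂ) (p := 2) (𝕜 := ℂ) volume
      (by rw [hD, map_zero])
    intro y
    have h5 := congrArg (starRingEnd ℂ) (congrFun (congrArg DFunLike.coe hD0) y)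
    simpa [D, sub_eq_zero] using h5
  ext ⟨x, y⟩
  have h6 : (fun x => K (x, y)) =ᵐ[volume] fun x => K' (x, y) := by
    filter_upwards [h2] with x hx using hx y
  exact congrFun ((Continuous.ae_eq_iff_eq volume (by fun_prop) (by fun_prop)).1 h6) x

theorem IsSmoothing.existsUnique_isKernel (hL : 0 < L) (h : IsSmoothing A a) :
    ∃! K, IsKernel A K :=
  ⟨_, h.isKernel hL, fun _ hK => hK.unique hL (h.isKernel hL)⟩

theorem IsSmoothing.kernel_eq (hL : 0 < L) (h : IsSmoothing A a) : kernel A = kernelSum a := by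
  have hK : ∃ K, IsKernel A K := ⟨_, h.isKernel hL⟩
  rw [kernel, dif_pos hK]
  exact hK.choose_spec.unique hL (h.isKernel hL)

theorem integrable_prod_of_continuousMap {N : ℕ} (K : C(Box d L × Box d L, ℂ)) (σ : Sym N) :
    Integrable (fun x : Fin N → Box d L => ∏ i, K (x i, x (σ i))) volume :=
  (by fun_prop : Continuous fun x : Fin N → Box d L => ∏ i, K (x i, x (σ i)))
    |>.integrable_of_hasCompactSupport (HasCompactSupport.of_compactSpace _)

/-- After expanding every kernel, the variable $x_j$ occurs in $a_{k_j}(x_j)$ and in the conjugate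
of $e_{k_{\sigma^{-1}(j)}}(x_j)$, so the integral factors into matrix elements of `A`. Shifting the
product by `σ` yields the inverse permutation. -/
theorem IsSmoothing.integral_prod_kernel {N : ℕ} (hL : 0 < L) (h : IsSmoothing A a) (σ : Sym N) :
    ∫ x : Fin N → Box d L, ∏ i, kernel A (x i, x (σ i)) = traceForm A σ⁻¹ := by
  rw [h.kernel_eq hL]
  let F : (Fin N → Fin d → ℤ) → (Fin N → Box d L) → ℂ := fun k x =>
    ∏ i, kernelTerm a (k i) (x i, x (σ i))
  have hF : ∀ k, Integrable (F k) volume := fun k =>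
    (by fun_prop : Continuous fun x : Fin N → Box d L => ∏ i, kernelTerm a (k i) (x i, x (σ i)))
      |>.integrable_of_hasCompactSupport (HasCompactSupport.of_compactSpace _)
  have hb : ∀ k x, ‖F k x‖ ≤ ∏ i, (‖a (k i)‖ * (Real.sqrt (L ^ d))⁻¹) := fun k x => by
    rw [norm_prod]
    exact Finset.prod_le_prod (fun i _ => norm_nonneg _)
      fun i _ => norm_kernelTerm_apply_le a (k i) _
  have hbs := summable_prod_of_nonneg N (fun _ k => ‖a k‖ * (Real.sqrt (L ^ d))⁻¹)
    (fun _ k => by positivity) fun _ => h.summable.mul_right _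
  have h1 := hasSum_integral_of_summable_integral_norm hF (by
    refine (hbs.mul_right (volume.real (Set.univ : Set (Fin N → Box d L)))).of_nonneg_of_le
      (fun k => integral_nonneg fun y => norm_nonneg _) fun k => ?_
    refine (integral_mono_of_nonneg (Filter.Eventually.of_forall fun y => norm_nonneg _)
      (integrable_const _) (Filter.Eventually.of_forall (hb k))).trans ?_
    rw [integral_const, smul_eq_mul, mul_comm])
  have h2 : ∀ x, ∑' k, F k x = ∏ i, kernelSum a (x i, x (σ i)) := fun x => by
    have hsum := (summable_norm_and_hasSum_prod N
      (fun i k => kernelTerm a k (x i, x (σ i))) fun i =>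
        (h.summable.mul_right (Real.sqrt (L ^ d))⁻¹).of_nonneg_of_le (fun _ => norm_nonneg _)
          fun k => norm_kernelTerm_apply_le a k _).2
    refine hsum.tsum_eq.trans (Finset.prod_congr rfl fun i _ => ?_)
    exact (hasSum_kernelTerm h.summable _).tsum_eq
  simp only [h2] at h1
  rw [← h1.tsum_eq, traceForm]
  refine tsum_congr fun k => ?_
  have h3 : ∀ x : Fin N → Box d L, F k x =
      ∏ j, a (k j) (x j) * (starRingEnd ℂ) (planeWave d L (k (σ⁻¹ j)) (x j)) := fun x => by
    simp only [F, kernelTerm, ContinuousMap.coe_mk, Finset.prod_mul_distrib]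
    congr 1
    rw [← Equiv.prod_comp σ fun j => (starRingEnd ℂ) (planeWave d L (k (σ⁻¹ j)) (x j))]
    simp
  simp only [h3]
  rw [integral_fintype_prod_volume_eq_prod
    (fun j y => a (k j) y * (starRingEnd ℂ) (planeWave d L (k (σ⁻¹ j)) y)),
    ← Equiv.prod_comp σ]
  refine Finset.prod_congr rfl fun j _ => ?_
  rw [← ContinuousMap.inner_toLp, ← h.map_planeWaveLp]
  simp [planeWaveLp]

end Kernel

/-! ### The heat operator -/

theorem summable_exp_neg_mul_int_sq {c : ℝ} (hc : 0 < c) :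
    Summable fun n : ℤ => Real.exp (-c * (n : ℝ) ^ 2) := by
  have h : Summable fun n : ℕ => Real.exp (-c * (n : ℝ) ^ 2) := by
    refine (summable_geometric_of_lt_one (Real.exp_pos (-c)).le
      (by simpa using hc)).of_nonneg_of_le (fun _ => (Real.exp_pos _).le)
      fun n => ?_
    rw [← Real.exp_nat_mul, Real.exp_le_exp]
    have hn : (n : ℝ) ≤ (n : ℝ) ^ 2 := by exact_mod_cast Nat.le_self_pow two_ne_zero n
    nlinarith
  refine Summable.of_nat_of_neg ?_ ?_ <;> simpa using h

section Heat

variable {d : ℕ} {L : ℝ}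

theorem summable_heat_weight (hL : 0 < L) {β : ℝ} (hβ : 0 < β) :
    Summable fun k : Fin d → ℤ => Real.exp (-β * momentumSq L k) := by
  have hc : 0 < β * (2 * Real.pi / L) ^ 2 := by positivity
  refine (summable_prod_of_nonneg d
    (fun _ (n : ℤ) => Real.exp (-(β * (2 * Real.pi / L) ^ 2) * (n : ℝ) ^ 2))
    (fun _ _ => (Real.exp_pos _).le) fun _ => summable_exp_neg_mul_int_sq hc).congr fun k => ?_
  rw [← Real.exp_sum, momentumSq, Finset.mul_sum]
  congr 1
  refine Finset.sum_congr rfl fun j _ => ?_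
  ring

theorem hasSum_heatOp (hL : 0 < L) {β : ℝ} (hβ : 0 < β) :
    HasSum (fun k : Fin d → ℤ => (Real.exp (-β * momentumSq L k) : ℂ) •
      InnerProductSpace.rankOne ℂ (planeWaveLp d L k) (planeWaveLp d L k)) (heatOp d L β) := by
  refine (Summable.of_norm ((summable_heat_weight hL hβ).congr fun k => ?_)).hasSum
  rw [norm_smul, InnerProductSpace.norm_rankOne, (orthonormal_planeWaveLp d hL).1,
    Complex.norm_real, Real.norm_of_nonneg (Real.exp_pos _).le]
  ring

theorem hasSum_heatOp_apply (hL : 0 < L) {β : ℝ} (hβ : 0 < β) (φ : H1 d L) :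
    HasSum (fun k : Fin d → ℤ => ((Real.exp (-β * momentumSq L k) : ℂ) *
      inner ℂ (planeWaveLp d L k) φ) • planeWaveLp d L k) (heatOp d L β φ) := by
  refine ((hasSum_heatOp hL hβ).mapL (ContinuousLinearMap.apply ℂ _ φ)).congr_fun fun k => ?_
  simp [smul_smul]

theorem heatOp_planeWaveLp (hL : 0 < L) {β : ℝ} (hβ : 0 < β) (k : Fin d → ℤ) :
    heatOp d L β (planeWaveLp d L k) =
      (Real.exp (-β * momentumSq L k) : ℂ) • planeWaveLp d L k := by
  classical
  refine (hasSum_heatOp_apply hL hβ _).unique ?_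
  convert hasSum_single k fun l hl => ?_ using 1
  · rw [orthonormal_iff_ite.1 (orthonormal_planeWaveLp d hL), if_pos rfl, mul_one]
  · rw [orthonormal_iff_ite.1 (orthonormal_planeWaveLp d hL), if_neg hl, mul_zero, zero_smul]

theorem heatOp_mul_heatOp (hL : 0 < L) {s t : ℝ} (hs : 0 < s) (ht : 0 < t) :
    heatOp d L s * heatOp d L t = heatOp d L (s + t) := by
  refine ContinuousLinearMap.ext_on (s := Set.range (planeWaveBasis d hL)) ?_ ?_
  · rw [Submodule.dense_iff_topologicalClosure_eq_top]
    exact (planeWaveBasis d hL).dense_span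
  · rintro _ ⟨k, rfl⟩
    rw [coe_planeWaveBasis, mul_apply_eq_comp, heatOp_planeWaveLp hL ht, map_smul,
      heatOp_planeWaveLp hL hs, heatOp_planeWaveLp hL (add_pos hs ht), smul_smul,
      ← Complex.ofReal_mul, ← Real.exp_add]
    congr 3
    ring

theorem star_heatOp (hL : 0 < L) {β : ℝ} (hβ : 0 < β) : star (heatOp d L β) = heatOp d L β := by
  refine (hasSum_heatOp hL hβ).star.unique ((hasSum_heatOp hL hβ).congr_fun fun k => ?_)
  rw [star_smul, ContinuousLinearMap.star_eq_adjoint, InnerProductSpace.adjoint_rankOne,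
    Complex.star_def, Complex.conj_ofReal]

/-- By the semigroup law it is the square of a self-adjoint operator; the same law identifies the
positive square root as the operator at `β / 2`. -/
theorem heatOp_nonneg (hL : 0 < L) {β : ℝ} (hβ : 0 < β) : 0 ≤ heatOp d L β := by
  have h := star_mul_self_nonneg (heatOp d L (β / 2))
  rwa [star_heatOp hL (half_pos hβ), heatOp_mul_heatOp hL (half_pos hβ) (half_pos hβ),
    add_halves] at h

theorem opSqrt_heatOp (hL : 0 < L) {β : ℝ} (hβ : 0 < β) :
    opSqrt (heatOp d L β) = heatOp d L (β / 2) :=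
  CFC.sqrt_unique
    (by rw [heatOp_mul_heatOp hL (half_pos hβ) (half_pos hβ), add_halves])
    (heatOp_nonneg hL (half_pos hβ))

theorem norm_planeWave_le (k : Fin d → ℤ) : ‖planeWave d L k‖ ≤ (Real.sqrt (L ^ d))⁻¹ :=
  (ContinuousMap.norm_le _ (by positivity)).2 fun x => (norm_planeWave_apply k x).le

/-- The continuous representative of `e^{βΔ} φ`. -/
def heatSmooth (β : ℝ) (φ : H1 d L) : C(Box d L, ℂ) :=
  ∑' k : Fin d → ℤ, ((Real.exp (-β * momentumSq L k) : ℂ) *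
    inner ℂ (planeWaveLp d L k) φ) • planeWave d L k

theorem norm_heatSmooth_term_le (hL : 0 < L) (β : ℝ) (φ : H1 d L) (k : Fin d → ℤ) :
    ‖((Real.exp (-β * momentumSq L k) : ℂ) * inner ℂ (planeWaveLp d L k) φ) • planeWave d L k‖ ≤
      Real.exp (-β * momentumSq L k) * (‖φ‖ * (Real.sqrt (L ^ d))⁻¹) := by
  rw [norm_smul, norm_mul, Complex.norm_real, Real.norm_of_nonneg (Real.exp_pos _).le, mul_assoc]
  refine mul_le_mul_of_nonneg_left ?_ (Real.exp_pos _).le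
  refine mul_le_mul ?_ (norm_planeWave_le k) (norm_nonneg _) (norm_nonneg _)
  simpa [(orthonormal_planeWaveLp d hL).1] using norm_inner_le_norm (𝕜 := ℂ) (planeWaveLp d L k) φ

theorem toLp_heatSmooth (hL : 0 < L) {β : ℝ} (hβ : 0 < β) (φ : H1 d L) :
    ContinuousMap.toLp (E := ℂ) 2 volume ℂ (heatSmooth β φ) = heatOp d L β φ := by
  have h : Summable fun k : Fin d → ℤ => ((Real.exp (-β * momentumSq L k) : ℂ) *
      inner ℂ (planeWaveLp d L k) φ) • planeWave d L k :=
    Summable.of_norm (((summable_heat_weight hL hβ).mul_right _).of_nonneg_of_le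
      (fun _ => norm_nonneg _) (norm_heatSmooth_term_le hL β φ))
  refine (h.hasSum.mapL (ContinuousMap.toLp (E := ℂ) 2 volume ℂ)).unique ?_
  refine (hasSum_heatOp_apply hL hβ φ).congr_fun fun k => ?_
  rw [map_smul, planeWaveLp]

theorem norm_heatSmooth_le (hL : 0 < L) {β : ℝ} (hβ : 0 < β) (φ : H1 d L) :
    ‖heatSmooth β φ‖ ≤ (∑' k : Fin d → ℤ, Real.exp (-β * momentumSq L k)) *
      (‖φ‖ * (Real.sqrt (L ^ d))⁻¹) :=
  tsum_of_norm_bounded ((summable_heat_weight hL hβ).hasSum.mul_right _)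
    (norm_heatSmooth_term_le hL β φ)

theorem isSmoothing_heatOp (hL : 0 < L) {β : ℝ} (hβ : 0 < β) :
    IsSmoothing (heatOp d L β)
      fun k => (Real.exp (-β * momentumSq L k) : ℂ) • planeWave d L k where
  map_planeWaveLp k := by rw [heatOp_planeWaveLp hL hβ, map_smul, planeWaveLp]
  summable := by
    refine ((summable_heat_weight hL hβ).mul_right (Real.sqrt (L ^ d))⁻¹).of_nonneg_of_le
      (fun _ => norm_nonneg _) fun k => ?_
    rw [norm_smul, Complex.norm_real, Real.norm_of_nonneg (Real.exp_pos _).le]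
    exact mul_le_mul_of_nonneg_left (norm_planeWave_le k) (Real.exp_pos _).le

/-- The right factor $G_L^{1/2}$ supplies the summable weight of $e_k$. The left one turns
$e^{-f}e_k$ into a continuous function with sup norm bounded uniformly in $k$. -/
theorem isSmoothing_heatOpTilde (hL : 0 < L) {β : ℝ} (hβ : 0 < β) (f : C(Box d L, ℝ)) :
    IsSmoothing (heatOpTilde β f) fun k => (Real.exp (-(β / 2) * momentumSq L k) : ℂ) •
      heatSmooth (β / 2) (mulOp (expNeg f) (planeWaveLp d L k)) where
  map_planeWaveLp k := by
    rw [heatOpTilde, opSqrt_heatOp hL hβ, mul_apply_eq_comp,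
      mul_apply_eq_comp, heatOp_planeWaveLp hL (half_pos hβ), map_smul, map_smul,
      map_smul, toLp_heatSmooth hL (half_pos hβ)]
  summable := by
    refine ((summable_heat_weight hL (half_pos hβ)).mul_right
      ((∑' k : Fin d → ℤ, Real.exp (-(β / 2) * momentumSq L k)) *
        (‖mulOp (expNeg f)‖ * (Real.sqrt (L ^ d))⁻¹))).of_nonneg_of_le
      (fun _ => norm_nonneg _) fun k => ?_
    rw [norm_smul, Complex.norm_real, Real.norm_of_nonneg (Real.exp_pos _).le]
    refine mul_le_mul_of_nonneg_left ?_ (Real.exp_pos _).le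
    refine (norm_heatSmooth_le hL (half_pos hβ) _).trans ?_
    refine mul_le_mul_of_nonneg_left ?_ (tsum_nonneg fun _ => (Real.exp_pos _).le)
    refine mul_le_mul_of_nonneg_right ?_ (by positivity)
    simpa [(orthonormal_planeWaveLp d hL).1] using
      (mulOp (expNeg f)).le_opNorm (planeWaveLp d L k)

end Heat

/-! ### The generating functionals -/

section Sums

variable {d N : ℕ} {L : ℝ} {A : H1 d L →L[ℂ] H1 d L} {a : (Fin d → ℤ) → C(Box d L, ℂ)}

theorem IsSmoothing.opTrace_permOp (hL : 0 < L) (h : IsSmoothing A a) (σ : Sym N) :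
    opTrace (tensorPower N A * permOp d L σ) = traceForm A σ :=
  (hasOpTrace_tensorPower_mul_permOp hL h.summable_norm σ).opTrace_eq

theorem IsSmoothing.opTrace_algOp (hL : 0 < L) (h : IsSmoothing A a) (g : GrpAlg N) :
    opTrace (tensorPower N A * algOp d L g) = evalAt (traceForm A) g :=
  (hasOpTrace_tensorPower_mul_algOp hL h.summable_norm g).opTrace_eq

theorem IsSmoothing.opTrace_projPB {p : ℕ} (hL : 0 < L) (h : IsSmoothing A a)
    (T : ∀ μ : Frame p N, Tableau N μ.1) :
    opTrace (tensorPower N A * projPB d L T) = ∑ μ, evalAt (traceForm A) (dElt (T μ)) := by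
  rw [projPB, Finset.mul_sum]
  exact (HasOpTrace.sum fun μ =>
    hasOpTrace_tensorPower_mul_algOp hL h.summable_norm (dElt (T μ))).opTrace_eq

theorem IsSmoothing.sum_chi_mul_opTrace (hL : 0 < L) (h : IsSmoothing A a) {μ : YoungDiagram}
    (T : Tableau N μ) :
    ∑ σ : Sym N, chi T σ * opTrace (tensorPower N A * permOp d L σ) =
      N.factorial * evalAt (traceForm A) (dElt T) := by
  simp only [h.opTrace_permOp hL]
  exact sum_chi_mul T (traceForm_conj A)

theorem IsSmoothing.integral_immanant (hL : 0 < L) (h : IsSmoothing A a) {μ : YoungDiagram}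
    (T : Tableau N μ) :
    ∫ x : Fin N → Box d L, immanant T (Matrix.of fun i j => kernel A (x i, x j)) =
      N.factorial * evalAt (traceForm A) (dElt T) := by
  simp only [immanant, Matrix.of_apply]
  rw [integral_finsetSum _ fun σ _ => (integrable_prod_of_continuousMap (kernel A) σ).const_mul _]
  simp only [integral_const_mul, h.integral_prod_kernel hL]
  rw [← sum_chi_mul T (traceForm_conj A)]
  exact Finset.sum_congr rfl fun σ _ => by rw [class_fun_inv (traceForm_conj A)]

end Sums

/-- There is a Young frame with a single row. -/
theorem nonempty_frame {p : ℕ} (hp : 0 < p) (N : ℕ) : Nonempty (Frame p N) := by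
  let μ : YoungDiagram :=
    ⟨{0} ×ˢ Finset.range N, by
      rintro ⟨i, j⟩ ⟨i', j'⟩ ⟨h1, h2⟩ h
      simp only [Finset.coe_product, Finset.coe_singleton, Set.mem_prod, Set.mem_singleton_iff,
        Finset.coe_range, Set.mem_Iio] at h ⊢
      simp only at h1 h2
      omega⟩
  refine ⟨⟨μ, by simp [μ, YoungDiagram.card], not_lt.1 fun h => ?_⟩⟩
  have h1 : (1, 0) ∈ μ := YoungDiagram.mem_iff_lt_colLen.2 (lt_of_le_of_lt hp h)
  have h2 := (YoungDiagram.mem_cells _).2 h1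
  simp [μ] at h2

end ParaStat

end

open ParaStat MeasureTheory
theorem lemma3p1 (d p N : ℕ) (hd : 0 < d) (hp : 0 < p) (L β : ℝ) (hL : 0 < L) (hβ : 0 < β)
    (f : C(Box d L, ℝ)) (hf : ∀ x, 0 ≤ f x) (T : ∀ μ : Frame p N, Tableau N μ.1) :
    -- all operators, traces and kernels below are well defined
    ((∃! B : HN d N L →L[ℂ] HN d N L, IsTensorPower (heatOp d L β) B) ∧
      (∃! B : HN d N L →L[ℂ] HN d N L, IsTensorPower (heatOpTilde β f) B) ∧
      (∃! K, IsKernel (heatOp d L β) K) ∧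
      (∃! K, IsKernel (heatOpTilde β f) K) ∧
      (∀ σ : Sym N, IsTraceClass (tensorPower N (heatOp d L β) * permOp d L σ)) ∧
      (∀ σ : Sym N, IsTraceClass (tensorPower N (heatOpTilde β f) * permOp d L σ))) ∧
    -- para-fermions: the denominators do not vanish, and the two formulas hold
    ((∑ μ : Frame p N,
        opTrace (tensorPower N (heatOp d L β) * algOp d L (dElt (T μ).transpose))) ≠ 0 ∧
      (∑ μ : Frame p N, ∑ σ : Sym N, chi (T μ).transpose σ *
        opTrace (tensorPower N (heatOp d L β) * permOp d L σ)) ≠ 0 ∧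
      (∑ μ : Frame p N, ∫ x : Fin N → Box d L, immanant (T μ).transpose
        (Matrix.of fun i j => kernel (heatOp d L β) (x i, x j))) ≠ 0 ∧
      genFunPF β f T =
        (∑ μ : Frame p N, ∑ σ : Sym N, chi (T μ).transpose σ *
          opTrace (tensorPower N (heatOpTilde β f) * permOp d L σ)) /
        (∑ μ : Frame p N, ∑ σ : Sym N, chi (T μ).transpose σ *
          opTrace (tensorPower N (heatOp d L β) * permOp d L σ)) ∧
      genFunPF β f T =
        (∑ μ : Frame p N, ∫ x : Fin N → Box d L, immanant (T μ).transpose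
          (Matrix.of fun i j => kernel (heatOpTilde β f) (x i, x j))) /
        (∑ μ : Frame p N, ∫ x : Fin N → Box d L, immanant (T μ).transpose
          (Matrix.of fun i j => kernel (heatOp d L β) (x i, x j)))) ∧
    -- para-bosons: the denominators do not vanish, and the two formulas hold
    (opTrace (tensorPower N (heatOp d L β) * projPB d L T) ≠ 0 ∧
      (∑ μ : Frame p N, ∑ σ : Sym N, chi (T μ) σ *
        opTrace (tensorPower N (heatOp d L β) * permOp d L σ)) ≠ 0 ∧
      (∑ μ : Frame p N, ∫ x : Fin N → Box d L, immanant (T μ)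
        (Matrix.of fun i j => kernel (heatOp d L β) (x i, x j))) ≠ 0 ∧
      genFunPB β f T =
        (∑ μ : Frame p N, ∑ σ : Sym N, chi (T μ) σ *
          opTrace (tensorPower N (heatOpTilde β f) * permOp d L σ)) /
        (∑ μ : Frame p N, ∑ σ : Sym N, chi (T μ) σ *
          opTrace (tensorPower N (heatOp d L β) * permOp d L σ)) ∧
      genFunPB β f T =
        (∑ μ : Frame p N, ∫ x : Fin N → Box d L, immanant (T μ)
          (Matrix.of fun i j => kernel (heatOpTilde β f) (x i, x j))) /
        (∑ μ : Frame p N, ∫ x : Fin N → Box d L, immanant (T μ)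
          (Matrix.of fun i j => kernel (heatOp d L β) (x i, x j)))) := by
  have hG := isSmoothing_heatOp (d := d) hL hβ
  have hG' := isSmoothing_heatOpTilde hL hβ f
  have hN : (N.factorial : ℂ) ≠ 0 := Nat.cast_ne_zero.2 N.factorial_ne_zero
  have := nonempty_frame hp N
  -- The frames `ν μ` are arbitrary, so that the same bound serves the given tableaux and their
  -- transposes.
  have hpos : ∀ {ν : Frame p N → YoungDiagram} (t : ∀ μ, Tableau N (ν μ)),
      ∑ μ : Frame p N, evalAt (traceForm (heatOp d L β)) (dElt (t μ)) ≠ 0 := by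
    open scoped ComplexOrder in
    exact fun t => (Finset.sum_pos (fun μ _ => evalAt_traceForm_dElt_pos hd hL
      (fun k => Real.exp_pos _) (summable_heat_weight hL hβ) (heatOp_planeWaveLp hL hβ) (t μ))
      Finset.univ_nonempty).ne'
  have h1 := hpos T
  have h2 := hpos fun μ => (T μ).transpose
  refine ⟨⟨existsUnique_isTensorPower hL hG.summable_norm,
    existsUnique_isTensorPower hL hG'.summable_norm, hG.existsUnique_isKernel hL,
    hG'.existsUnique_isKernel hL,
    fun σ => ⟨_, hasOpTrace_tensorPower_mul_permOp hL hG.summable_norm σ⟩,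
    fun σ => ⟨_, hasOpTrace_tensorPower_mul_permOp hL hG'.summable_norm σ⟩⟩, ?_, ?_⟩
  · simp only [genFunPF, hG.opTrace_algOp hL, hG'.opTrace_algOp hL, hG.sum_chi_mul_opTrace hL,
      hG'.sum_chi_mul_opTrace hL, hG.integral_immanant hL, hG'.integral_immanant hL,
      ← Finset.mul_sum, mul_div_mul_left _ _ hN]
    exact ⟨h2, mul_ne_zero hN h2, mul_ne_zero hN h2, trivial, trivial⟩
  · simp only [genFunPB, hG.opTrace_projPB hL, hG'.opTrace_projPB hL, hG.sum_chi_mul_opTrace hL,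
      hG'.sum_chi_mul_opTrace hL, hG.integral_immanant hL, hG'.integral_immanant hL,
      ← Finset.mul_sum, mul_div_mul_left _ _ hN]
    exact ⟨h1, mul_ne_zero hN h1, mul_ne_zero hN h1, trivial, trivial⟩
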